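/- Let $A$ be a finite-dimensional algebra over a field, let $\mathscr{A}=A\text{-mod}$ be the category of finitely generated left $A$-modules, and let $\mathscr{C}$ be a full additive subcategory of $\mathscr{A}$, closed under direct summands, which is contravariantly finite (every $D\in\mathscr{A}$ has a right $\mathscr{C}$-approximation, i.e. a morphism $C\to D$ with $C\in\mathscr{C}$ through which every morphism from an object of $\mathscr{C}$ to $D$ factors) and admissible (every right $\mathscr{C}$-approximation is epic). A complex $X$ is $\mathscr{C}$-acyclic (or $\mathrm{Hom}_{\mathscr{A}}(\mathscr{C},-)$-exact) if $\mathrm{Hom}_{\mathscr{A}}(C,X)$ is acyclic for all $C\in\mathscr{C}$, and $\mathrm{Hom}_{\mathscr{A}}(-,\mathscr{C})$-exact if $\mathrm{Hom}_{\mathscr{A}}(X,C)$ is acyclic for all $C\in\mathscr{C}$. Let $D^b_{\mathscr{C}}(\mathscr{A})=K^b(\mathscr{A})/K^b_{\mathscr{C}\text{-ac}}(\mathscr{A})$ be the Verdier quotient of the bounded homotopy category by the $\mathscr{C}$-acyclic complexes, and let $D_{\mathscr{C}\text{-sg}}(\mathscr{A})=D^b_{\mathscr{C}}(\mathscr{A})/K^b(\mathscr{C})$.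 Modules are viewed as complexes concentrated in degree $0$; this gives the canonical functor $\mathscr{A}\to K^b(\mathscr{A})\to D^b_{\mathscr{C}}(\mathscr{A})\to D_{\mathscr{C}\text{-sg}}(\mathscr{A})$. For $M\in\mathscr{A}$ let $C_M\to M$ be a left $\mathscr{C}$-resolution, i.e. a morphism of complexes with $C_M^n\in\mathscr{C}$ for all $n$ and $C_M^n=0$ for $n>0$ which becomes a quasi-isomorphism after applying $\mathrm{Hom}_{\mathscr{A}}(C,-)$ for every $C\in\mathscr{C}$; put $\mathrm{Ext}^n_{\mathscr{C}}(M,N)=H^n\mathrm{Hom}_{\mathscr{A}}(C_M,N)$, and let ${}^{\perp_{\mathscr{C}}}\mathscr{C}$ be the class of all $M$ with $\mathrm{Ext}^i_{\mathscr{C}}(M,C)=0$ for all $C\in\mathscr{C}$ and $i\ge 1$. Let $\mathscr{C}(M,N)\subseteq\mathrm{Hom}_{\mathscr{A}}(M,N)$ be the subgroup of the morphisms that factor through an object of $\mathscr{C}$. Let $\mathscr{G}(\mathscr{C})$ be the full subcategory of the modules isomorphic to $\mathrm{Im}(C^{-1}\to C^0)$ for some acyclic complex $\cdots\to C^{-1}\to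 C^0\to C^1\to\cdots$ with terms in $\mathscr{C}$ that is both $\mathrm{Hom}_{\mathscr{A}}(\mathscr{C},-)$-exact and $\mathrm{Hom}_{\mathscr{A}}(-,\mathscr{C})$-exact. With the $\mathrm{Hom}_{\mathscr{A}}(\mathscr{C},-)$-exact complexes $0\to L\to M\to N\to 0$ with $L,M,N\in\mathscr{G}(\mathscr{C})$ as short exact sequences, $\mathscr{G}(\mathscr{C})$ is a Frobenius category; its stable category $\underline{\mathscr{G}(\mathscr{C})}$ has the same objects, and its morphisms are those of $\mathscr{G}(\mathscr{C})$ modulo the ones that factor through a projective-injective object. Let $\theta:\mathscr{G}(\mathscr{C})\to D_{\mathscr{C}\text{-sg}}(\mathscr{A})$ be the restriction of the canonical functor. (1) For all $M\in{}^{\perp_{\mathscr{C}}}\mathscr{C}$ and $N\in\mathscr{A}$, the canonical functor induces an isomorphism of abelian groups $$\mathrm{Hom}_{\mathscr{A}}(M,N)/\mathscr{C}(M,N)\;\cong\;\mathrm{Hom}_{D_{\mathscr{C}\text{-sg}}(\mathscr{A})}(M,N).$$ (2) The functor $\theta$ induces a fully faithful functor $\theta':\underline{\mathscr{G}(\mathscr{C})}\to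 D_{\mathscr{C}\text{-sg}}(\mathscr{A})$, i.e. $\theta$ is the composition of the quotient functor $\mathscr{G}(\mathscr{C})\to\underline{\mathscr{G}(\mathscr{C})}$ with $\theta'$. -/

import Mathlib

open CategoryTheory Limits Opposite Pretriangulated ZeroObject

universe w v u

noncomputable section

namespace RelSing

variable {𝒜 : Type u} [Category.{v} 𝒜] [Abelian 𝒜]

section Subcategories

variable (C : ObjectProperty 𝒜)

/-- A right `C`-approximation of `D`: a morphism `f : X ⟶ D` with `X` in `C` through which every
morphism from an object of `C` to `D` factors. -/
def IsRightApproximation {X D : 𝒜} (f : X ⟶ D) : Prop :=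
  C X ∧ ∀ ⦃X' : 𝒜⦄ (g : X' ⟶ D), C X' → ∃ h : X' ⟶ X, h ≫ f = g

/-- `C` is contravariantly finite in `𝒜`: every object has a right `C`-approximation. -/
def IsContravariantlyFinite : Prop :=
  ∀ D : 𝒜, ∃ (X : 𝒜) (f : X ⟶ D), IsRightApproximation C f

/-- `C` is admissible: it is contravariantly finite and every right `C`-approximation is epic. -/
structure IsAdmissible : Prop where
  contravariantlyFinite : IsContravariantlyFinite C
  epi_of_isRightApproximation : ∀ ⦃X D : 𝒜⦄ (f : X ⟶ D), IsRightApproximation C f → Epi f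

/-- The complex of abelian groups `Hom_𝒜(c, K)`, with `Hom_𝒜(c, K ^ n)` in degree `n`. -/
abbrev homFrom (c : 𝒜) (K : CochainComplex 𝒜 ℤ) : CochainComplex AddCommGrpCat.{v} ℤ :=
  ((preadditiveCoyoneda.obj (op c)).mapHomologicalComplex (.up ℤ)).obj K

/-- The complex of abelian groups `Hom_𝒜(K, c)`. The group at the index `n` is `Hom_𝒜(K ^ n, c)`
and the differential goes from the index `n + 1` to the index `n`, so that the cohomological
degree of the index `n` is `- n`. -/
abbrev homTo (K : CochainComplex 𝒜 ℤ) (c : 𝒜) :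
    HomologicalComplex AddCommGrpCat.{v} (ComplexShape.up ℤ).symm :=
  ((preadditiveYoneda.obj c).mapHomologicalComplex (ComplexShape.up ℤ).symm).obj K.op

/-- `K` is `C`-acyclic, i.e. `Hom_𝒜(C, -)`-exact. -/
def IsHomFromExact (K : CochainComplex 𝒜 ℤ) : Prop :=
  ∀ c : 𝒜, C c → (homFrom c K).Acyclic

/-- `K` is `Hom_𝒜(-, C)`-exact. -/
def IsHomToExact (K : CochainComplex 𝒜 ℤ) : Prop :=
  ∀ c : 𝒜, C c → (homTo K c).Acyclic

/-- `f` is a `C`-quasi-isomorphism. -/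
def IsRelQuasiIso {K L : CochainComplex 𝒜 ℤ} (f : K ⟶ L) : Prop :=
  ∀ c : 𝒜, C c →
    QuasiIso (((preadditiveCoyoneda.obj (op c)).mapHomologicalComplex (.up ℤ)).map f)

/-- A left `C`-resolution (`C`-proper `C`-resolution) of `M`. -/
structure LeftResolution (M : 𝒜) where
  /-- the resolving complex -/
  complex : CochainComplex 𝒜 ℤ
  mem : ∀ n : ℤ, C (complex.X n)
  isStrictlyLE : complex.IsStrictlyLE 0
  /-- the augmentation to `M`, seen as a complex concentrated in degree `0` -/
  π : complex ⟶ (CochainComplex.singleFunctor 𝒜 0).obj M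
  isRelQuasiIso : IsRelQuasiIso C π

variable {C} in
/-- The relative extension group `Ext_C^n(M, N) = H^n Hom_𝒜(C_M, N)`, computed with the left
`C`-resolution `R = C_M` of `M`. -/
def LeftResolution.extGroup {M : 𝒜} (R : LeftResolution C M) (n : ℤ) (N : 𝒜) : AddCommGrpCat.{v} :=
  (homTo R.complex N).homology (-n)

/-- The class of the objects `M` with `Ext_C^i(M, c) = 0` for all `c` in `C` and `i ≥ 1`.
(The relative extension groups do not depend on the choice of the left `C`-resolution.) -/
def leftPerp : ObjectProperty 𝒜 :=
  fun M ↦ ∃ R : LeftResolution C M, ∀ c : 𝒜, C c → ∀ i : ℤ, 1 ≤ i → IsZero (R.extGroup i c)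

/-- The Gorenstein category `𝒢(C)`. -/
def gorenstein : ObjectProperty 𝒜 :=
  fun M ↦ ∃ K : CochainComplex 𝒜 ℤ, (∀ n : ℤ, C (K.X n)) ∧ K.Acyclic ∧
    IsHomFromExact C K ∧ IsHomToExact C K ∧ Nonempty (M ≅ image (K.d (-1) 0))

/-- The class `ε` of conflations of `𝒢(C)`: the sequences `0 ⟶ L ⟶ M ⟶ N ⟶ 0` with terms in
`𝒢(C)` which become short exact after applying `Hom_𝒜(c, -)` for all `c` in `C`. -/
def IsConflation (S : ShortComplex (gorenstein C).FullSubcategory) : Prop :=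
  ∀ c : 𝒜, C c → ((S.map (gorenstein C).ι).map (preadditiveCoyoneda.obj (op c))).ShortExact

/-- The projective objects of the exact category `(𝒢(C), ε)`. -/
def IsConflationProjective (P : (gorenstein C).FullSubcategory) : Prop :=
  ∀ S : ShortComplex (gorenstein C).FullSubcategory, IsConflation C S →
    ∀ f : P ⟶ S.X₃, ∃ g : P ⟶ S.X₂, g ≫ S.g = f

/-- The injective objects of the exact category `(𝒢(C), ε)`. -/
def IsConflationInjective (I : (gorenstein C).FullSubcategory) : Prop :=
  ∀ S : ShortComplex (gorenstein C).FullSubcategory, IsConflation C S →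
    ∀ f : S.X₁ ⟶ I, ∃ g : S.X₂ ⟶ I, S.f ≫ g = f

/-- Two morphisms of `𝒢(C)` are identified in the stable category when their difference factors
through a projective-injective object of `(𝒢(C), ε)`. -/
def stableRel : HomRel (gorenstein C).FullSubcategory :=
  fun X Y f g ↦ ∃ (P : (gorenstein C).FullSubcategory) (a : X ⟶ P) (b : P ⟶ Y),
    IsConflationProjective C P ∧ IsConflationInjective C P ∧ f - g = a ≫ b

/-- The stable category of `𝒢(C)`. -/
abbrev StableGorenstein := CategoryTheory.Quotient (stableRel C)

/-- The canonical functor from `𝒢(C)` to its stable category. -/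
abbrev toStable : (gorenstein C).FullSubcategory ⥤ StableGorenstein C :=
  Quotient.functor (stableRel C)

lemma prop_biprod [C.IsClosedUnderFiniteProducts] {X Y : 𝒜} (hX : C X) (hY : C Y) :
    C (X ⊞ Y) :=
  C.prop_of_isLimit_binaryFan (BinaryBiproduct.isLimit X Y) hX hY

instance [C.IsClosedUnderFiniteProducts] : C.IsClosedUnderIsomorphisms :=
  ObjectProperty.IsClosedUnderBinaryProducts.closedUnderIsomorphisms C

instance [C.IsClosedUnderFiniteProducts] : C.ContainsZero :=
  ⟨_, (isZero_zero 𝒜).of_iso (HasZeroObject.zeroIsoTerminal).symm, C.prop_terminal⟩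

/-- The group `C(M, N)` of the morphisms `M ⟶ N` that factor through an object of `C`. -/
def factoring [C.IsClosedUnderFiniteProducts] (M N : 𝒜) : AddSubgroup (M ⟶ N) where
  carrier := { f | ∃ (c : 𝒜) (a : M ⟶ c) (b : c ⟶ N), C c ∧ a ≫ b = f }
  zero_mem' := by
    obtain ⟨Z, -, hZ⟩ := C.exists_prop_of_containsZero
    exact ⟨Z, 0, 0, hZ, by simp⟩
  add_mem' := by
    rintro _ _ ⟨c, a, b, hc, rfl⟩ ⟨c', a', b', hc', rfl⟩
    exact ⟨c ⊞ c', biprod.lift a a', biprod.desc b b', prop_biprod C hc hc', by simp⟩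
  neg_mem' := by
    rintro _ ⟨c, a, b, hc, rfl⟩
    exact ⟨c, a, -b, hc, by simp⟩

end Subcategories

section HomotopyCategories

variable (𝒜)

/-- The objects of the homotopy category `K(𝒜)` that are bounded complexes. -/
def bounded : ObjectProperty (HomotopyCategory 𝒜 (.up ℤ)) :=
  fun X ↦ ∃ a b : ℤ, CochainComplex.IsStrictlyGE X.as a ∧ CochainComplex.IsStrictlyLE X.as b

instance : (bounded 𝒜).ContainsZero where
  exists_zero :=
    ⟨(HomotopyCategory.quotient _ _).obj 0, Functor.map_isZero _ (isZero_zero _),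
      0, 0, inferInstanceAs (CochainComplex.IsStrictlyGE (0 : CochainComplex 𝒜 ℤ) 0),
      inferInstanceAs (CochainComplex.IsStrictlyLE (0 : CochainComplex 𝒜 ℤ) 0)⟩

instance : (bounded 𝒜).IsStableUnderShift ℤ where
  isStableUnderShiftBy n :=
    { le_shift X hX := by
        obtain ⟨K : CochainComplex 𝒜 ℤ, rfl⟩ := X.quotient_obj_surjective
        obtain ⟨a, b, (ha : K.IsStrictlyGE a), (hb : K.IsStrictlyLE b)⟩ := hX
        rw [ObjectProperty.prop_shift_iff, HomotopyCategory.shift_quotient_obj]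
        exact ⟨a - n, b - n, K.isStrictlyGE_shift a n (a - n) (by lia),
          K.isStrictlyLE_shift b n (b - n) (by lia)⟩ }

lemma exists_iso_mappingCone (T : Triangle (HomotopyCategory 𝒜 (.up ℤ)))
    (hT : T ∈ distTriang (HomotopyCategory 𝒜 (.up ℤ))) :
    ∃ f : T.obj₁.as ⟶ T.obj₂.as,
      Nonempty (T.obj₃ ≅ (HomotopyCategory.quotient 𝒜 (.up ℤ)).obj
        (CochainComplex.mappingCone f)) := by
  obtain ⟨f : T.obj₁.as ⟶ T.obj₂.as, hf⟩ :=
    (HomotopyCategory.quotient _ _).map_surjective T.mor₁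
  exact ⟨f, ⟨Triangle.π₃.mapIso (isoTriangleOfIso₁₂ T _ hT
    (HomotopyCategory.mappingCone_triangleh_distinguished f) (Iso.refl _) (Iso.refl _)
      ((Category.comp_id _).trans (hf.symm.trans (Category.id_comp _).symm)))⟩⟩

lemma bounded_mappingCone {K L : CochainComplex 𝒜 ℤ} (f : K ⟶ L) (a₁ a₂ b₁ b₂ : ℤ)
    [K.IsStrictlyGE a₁] [L.IsStrictlyGE a₂] [K.IsStrictlyLE b₁] [L.IsStrictlyLE b₂] :
    bounded 𝒜 ((HomotopyCategory.quotient 𝒜 (.up ℤ)).obj (CochainComplex.mappingCone f)) := by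
  refine ⟨min (a₁ - 1) a₂, max b₁ b₂,
    CochainComplex.isStrictlyGE_mappingCone f a₁ a₂ _ (by simp) (by simp), ?_⟩
  change (CochainComplex.mappingCone f).IsStrictlyLE _
  rw [CochainComplex.isStrictlyLE_iff]
  intro i hi
  simp only [max_lt_iff] at hi
  rw [CochainComplex.mappingCone.isZero_X_iff]
  exact ⟨K.isZero_of_isStrictlyLE b₁ _ (by lia), L.isZero_of_isStrictlyLE b₂ _ (by lia)⟩

instance : (bounded 𝒜).IsTriangulatedClosed₃ where
  ext₃' T hT h₁ h₂ := by
    obtain ⟨a₁, b₁, _, _⟩ := h₁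
    obtain ⟨a₂, b₂, _, _⟩ := h₂
    obtain ⟨f, ⟨e⟩⟩ := exists_iso_mappingCone 𝒜 T hT
    exact ⟨_, bounded_mappingCone 𝒜 f a₁ a₂ b₁ b₂, ⟨e⟩⟩

instance : (bounded 𝒜).IsTriangulated where
  toIsTriangulatedClosed₂ := .of_isTriangulatedClosed₃

/-- The bounded homotopy category `K^b(𝒜)`. -/
abbrev Kb := (bounded 𝒜).FullSubcategory

/-- The functor `𝒜 ⥤ K^b(𝒜)` sending an object to the complex concentrated in degree `0`. -/
def toKb : 𝒜 ⥤ Kb 𝒜 :=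
  (bounded 𝒜).lift (HomotopyCategory.singleFunctor 𝒜 0) (fun X ↦ by
    rw [← HomotopyCategory.quotient_obj_singleFunctors_obj]
    exact ⟨0, 0,
      inferInstanceAs (((CochainComplex.singleFunctor 𝒜 0).obj X).IsStrictlyGE 0),
      inferInstanceAs (((CochainComplex.singleFunctor 𝒜 0).obj X).IsStrictlyLE 0)⟩)

instance : (toKb 𝒜).Additive := by
  dsimp [toKb]
  infer_instance

variable {𝒜}

variable (C : ObjectProperty 𝒜)

/-- The `C`-acyclic complexes, as objects of `K(𝒜)`. -/
def relAcyclic : ObjectProperty (HomotopyCategory 𝒜 (.up ℤ)) :=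
  fun X ↦ IsHomFromExact C X.as

lemma relAcyclic_iff (X : HomotopyCategory 𝒜 (.up ℤ)) :
    relAcyclic C X ↔ ∀ c : 𝒜, C c →
      (HomotopyCategory.subcategoryAcyclic AddCommGrpCat.{v}).inverseImage
        ((preadditiveCoyoneda.obj (op c)).mapHomotopyCategory (.up ℤ)) X := by
  refine forall₂_congr fun c _ ↦ ?_
  exact (HomotopyCategory.quotient_obj_mem_subcategoryAcyclic_iff_acyclic _).symm

instance : (relAcyclic C).IsClosedUnderIsomorphisms where
  of_iso e h := by
    rw [relAcyclic_iff] at h ⊢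
    exact fun c hc ↦ ObjectProperty.prop_of_iso _ e (h c hc)

instance : (relAcyclic C).IsTriangulated where
  exists_zero := ⟨0, isZero_zero _, by
    rw [relAcyclic_iff]
    exact fun c _ ↦ ObjectProperty.prop_zero _⟩
  isStableUnderShiftBy n := ⟨fun X hX ↦ by
    rw [ObjectProperty.prop_shift_iff]
    rw [relAcyclic_iff] at hX ⊢
    exact fun c hc ↦ ObjectProperty.le_shift _ n _ (hX c hc)⟩
  toIsTriangulatedClosed₂ := .mk' (fun T hT h₁ h₃ ↦ by
    rw [relAcyclic_iff] at h₁ h₃ ⊢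
    exact fun c hc ↦ ObjectProperty.ext_of_isTriangulatedClosed₂ _ T hT (h₁ c hc) (h₃ c hc))

/-- `K^b_{C-ac}(𝒜)`, as a class of objects of `K^b(𝒜)`. -/
def kbRelAcyclic : ObjectProperty (Kb 𝒜) :=
  (relAcyclic C).inverseImage (bounded 𝒜).ι

instance : (kbRelAcyclic C).IsTriangulated :=
  inferInstanceAs ((relAcyclic C).inverseImage (bounded 𝒜).ι).IsTriangulated

/-- The bounded `C`-derived category `D^b_C(𝒜) = K^b(𝒜) / K^b_{C-ac}(𝒜)`. -/
abbrev Db := (kbRelAcyclic C).trW.Localization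

/-- The quotient functor `K^b(𝒜) ⥤ D^b_C(𝒜)`. -/
abbrev Qb : Kb 𝒜 ⥤ Db C := (kbRelAcyclic C).trW.Q

/-- `K^b(C)`, as a class of objects of `K^b(𝒜)`: the bounded complexes with terms in `C`. -/
def kbOf : ObjectProperty (Kb 𝒜) :=
  fun X ↦ ∀ n : ℤ, C (X.obj.as.X n)

/-- `K^b(C)`, as a class of objects of `D^b_C(𝒜)`: the objects isomorphic in `D^b_C(𝒜)` to a
bounded complex with terms in `C`. -/
def dbOf : ObjectProperty (Db C) :=
  (kbOf C).map (Qb C)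

/-- A morphism from a bounded complex with terms in `C` to a `C`-acyclic complex is
null-homotopic. -/
lemma homotopy_zero {K L : CochainComplex 𝒜 ℤ} (a : ℤ) [K.IsStrictlyGE a]
    (hK : ∀ n : ℤ, C (K.X n)) (hL : IsHomFromExact C L) (m : ℕ) :
    ∀ f : K ⟶ L, (∀ i : ℤ, a + m ≤ i → f.f i = 0) → Nonempty (Homotopy f 0) := by
  induction m with
  | zero =>
    intro f hf
    refine ⟨Homotopy.ofEq ?_⟩
    ext i
    by_cases hi : i < a
    · exact (K.isZero_of_isStrictlyGE a i hi).eq_of_src _ _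
    · simpa using hf i (by simp; lia)
  | succ m hm =>
    intro f hf
    obtain ⟨h, hh⟩ : ∃ h : K.X (a + m) ⟶ L.X (a + m - 1),
        h ≫ L.d (a + m - 1) (a + m) = f.f (a + m) := by
      have hex := hL _ (hK (a + m)) (a + m)
      rw [HomologicalComplex.exactAt_iff' _ (a + m - 1) (a + m) (a + m + 1) (by simp) (by simp),
        ShortComplex.ab_exact_iff] at hex
      obtain ⟨h, hh⟩ := hex (f.f (a + m)) (by
        change f.f (a + m) ≫ L.d _ _ = 0
        rw [f.comm, hf _ (by push_cast; lia), comp_zero])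
      exact ⟨h, hh⟩
    let s : ∀ i j : ℤ, (ComplexShape.up ℤ).Rel j i → (K.X i ⟶ L.X j) := fun i j hij ↦
      if hi : i = a + m then
        (K.XIsoOfEq hi).hom ≫ h ≫ (L.XIsoOfEq (by simp at hij; lia)).hom else 0
    obtain ⟨g⟩ := hm (f - Homotopy.nullHomotopicMap' s) (by
      intro i hi
      have e : (Homotopy.nullHomotopicMap' s).f i = f.f i := by
        rw [Homotopy.nullHomotopicMap'_f (k₂ := i - 1) (k₁ := i) (k₀ := i + 1)
          (by simp) (by simp)]
        have h1 : s (i + 1) i (by simp) = 0 := dif_neg (by lia)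
        rw [h1, comp_zero, zero_add]
        by_cases hi' : i = a + m
        · subst hi'
          simp [s, hh]
        · have h2 : s i (i - 1) (by simp) = 0 := dif_neg hi'
          rw [h2, zero_comp, hf i (by push_cast; lia)]
      rw [HomologicalComplex.sub_f_apply, e, sub_self])
    exact ⟨(Homotopy.ofEq (by simp)).trans ((g.add (Homotopy.nullHomotopy' s)).trans
      (Homotopy.ofEq (by simp)))⟩

lemma kbOf_le_leftOrthogonal : kbOf C ≤ (kbRelAcyclic C).leftOrthogonal := by
  rintro X hX Y f hY
  obtain ⟨a, b, ha, hb⟩ := X.property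
  obtain ⟨g, hg⟩ := (HomotopyCategory.quotient 𝒜 (.up ℤ)).map_surjective
    (X := X.obj.as) (Y := Y.obj.as) f.hom
  obtain ⟨h⟩ := homotopy_zero C a hX hY (b - a + 1).toNat g (fun i hi ↦
    (CochainComplex.isZero_of_isStrictlyLE X.obj.as b i (by lia)).eq_of_src _ _)
  ext
  rw [← hg, HomotopyCategory.eq_of_homotopy _ _ h, Functor.map_zero]
  rfl

variable [C.IsClosedUnderFiniteProducts]

instance : (kbOf C).ContainsZero where
  exists_zero := by
    obtain ⟨Z, hZ, hZ'⟩ := C.exists_prop_of_containsZero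
    refine ⟨(toKb 𝒜).obj Z, (toKb 𝒜).map_isZero hZ, fun n ↦ ?_⟩
    refine C.prop_of_iso (IsZero.iso hZ ?_) hZ'
    change IsZero (((HomologicalComplex.single 𝒜 (.up ℤ) 0).obj Z).X n)
    by_cases hn : n = 0
    · subst hn
      exact hZ.of_iso (HomologicalComplex.singleObjXSelf (.up ℤ) 0 Z)
    · exact HomologicalComplex.isZero_single_obj_X _ _ _ _ hn

instance : (kbOf C).IsStableUnderShift ℤ where
  isStableUnderShiftBy n := ⟨fun X hX i ↦ by
    have e : ((shiftFunctor (Kb 𝒜) n).obj X).obj =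
        (HomotopyCategory.quotient 𝒜 (.up ℤ)).obj
          ((shiftFunctor (CochainComplex 𝒜 ℤ) n).obj X.obj.as) :=
      Eq.trans (by with_unfolding_all rfl)
        (HomotopyCategory.shift_quotient_obj X.obj.as n)
    rw [e]
    exact hX (i + n)⟩

instance : (kbOf C).IsTriangulatedClosed₃ where
  ext₃' T hT h₁ h₂ := by
    obtain ⟨a₁, b₁, _, _⟩ := T.obj₁.property
    obtain ⟨a₂, b₂, _, _⟩ := T.obj₂.property
    obtain ⟨f, ⟨e⟩⟩ := exists_iso_mappingCone 𝒜 _ ((bounded 𝒜).ι.map_distinguished T hT)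
    exact ⟨⟨_, bounded_mappingCone 𝒜 (K := T.obj₁.obj.as) (L := T.obj₂.obj.as) f a₁ a₂ b₁ b₂⟩, fun n ↦ C.prop_of_iso
      (HomologicalComplex.homotopyCofiber.XIsoBiprod f n (n + 1) rfl).symm
        (prop_biprod C (h₁ (n + 1)) (h₂ n)), ⟨(bounded 𝒜).fullyFaithfulι.preimageIso e⟩⟩

instance : (kbOf C).IsTriangulated where
  toIsTriangulatedClosed₂ := .of_isTriangulatedClosed₃

instance : ((kbOf C).ι ⋙ Qb C).Full where
  map_surjective {X Y} f := by
    obtain ⟨g, hg⟩ := ((kbOf_le_leftOrthogonal C _ X.property).map_bijective_of_isTriangulated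
      (Qb C) Y.obj).2 f
    exact ⟨(kbOf C).homMk g, hg⟩

instance : (dbOf C).IsTriangulated := by
  unfold dbOf
  rw [← Functor.essImage_ι_comp]
  infer_instance

/-- The `C`-singularity category `D_{C-sg}(𝒜) = D^b_C(𝒜) / K^b(C)`. -/
abbrev Dsg := (dbOf C).trW.Localization

/-- The quotient functor `D^b_C(𝒜) ⥤ D_{C-sg}(𝒜)`. -/
abbrev Qsg : Db C ⥤ Dsg C := (dbOf C).trW.Q

/-- The canonical functor `𝒜 ⥤ K^b(𝒜) ⥤ D^b_C(𝒜) ⥤ D_{C-sg}(𝒜)`. -/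
abbrev toDsg : 𝒜 ⥤ Dsg C := toKb 𝒜 ⋙ Qb C ⋙ Qsg C

/-- The functor `θ : 𝒢(C) ⥤ D_{C-sg}(𝒜)`. -/
abbrev theta : (gorenstein C).FullSubcategory ⥤ Dsg C := (gorenstein C).ι ⋙ toDsg C

end HomotopyCategories

end RelSing

end

/-! The engine is dimension shifting along classes with `IsSyzygyClosed`. One such class is
`gorenstein C`; for each M in `leftPerp C`, another consists of the cycles in degrees ≤ 0 of its
augmented left resolution. For M in such a class and c in C, every morphism M → c[n] in `Db C` with
n ≥ 1 vanishes (`IsSyzygyClosed.hom_shift_eq_zero`). Peeling off lowest terms one at a time, every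
morphism in `Db C` from M to a bounded complex over C therefore factors through such a complex in
degrees ≥ 0 (`IsSyzygyClosed.exists_factorization`).

A morphism M → N in `Dsg C` is a fraction whose denominator has a bounded complex over C as its
cone; by the factorization, the cone P may be taken in degrees ≥ 0. Then Hom(P, N[1]) = 0 for
reasons of degree, so the numerator extends to M → N in `Db C`: this is surjectivity. If f : M → N
dies in `Dsg C`, it factors in `Db C` through such a P, hence through the term P^0, which lies in C.
Since 𝒜 → `Db C` is fully faithful (`IsAdmissible.full`, `IsAdmissible.map_eq_zero`), both
conclusions descend to 𝒜, which gives (1).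

For (2), the projectives of the Gorenstein category are exactly the objects of C, and these are also
injective. Hence the stable relation is the one induced by θ (`stableRel_iff`), and the argument for
(1) applies to `gorenstein C`. -/

noncomputable section

namespace RelSing

variable {𝒜 : Type u} [Category.{v} 𝒜] [Abelian 𝒜] {C : ObjectProperty 𝒜}

set_option linter.unusedSectionVars false

/-! ### Relative exactness, tested on morphisms from objects of C. -/

section Exactness

lemma isHomFromExact_iff {K : CochainComplex 𝒜 ℤ} :
    IsHomFromExact C K ↔ ∀ c : 𝒜, C c → ∀ i j k : ℤ, i + 1 = j → j + 1 = k →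
      ∀ x : c ⟶ K.X j, x ≫ K.d j k = 0 → ∃ y : c ⟶ K.X i, y ≫ K.d i j = x := by
  refine forall₂_congr fun c _ ↦ ⟨fun h i j k hij hjk x hx ↦ ?_, fun h j ↦ ?_⟩
  · have hex := h j
    rw [HomologicalComplex.exactAt_iff' _ i j k (by simp; lia) (by simp; lia),
      ShortComplex.ab_exact_iff] at hex
    exact hex x hx
  · rw [HomologicalComplex.exactAt_iff' _ (j - 1) j (j + 1) (by simp) (by simp),
      ShortComplex.ab_exact_iff]
    exact fun x hx ↦ h (j - 1) j (j + 1) (by lia) rfl x hx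

lemma isHomToExact_iff {K : CochainComplex 𝒜 ℤ} :
    IsHomToExact C K ↔ ∀ c : 𝒜, C c → ∀ i j k : ℤ, i + 1 = j → j + 1 = k →
      ∀ x : K.X j ⟶ c, K.d i j ≫ x = 0 → ∃ y : K.X k ⟶ c, K.d j k ≫ y = x := by
  refine forall₂_congr fun c _ ↦ ⟨fun h i j k hij hjk x hx ↦ ?_, fun h j ↦ ?_⟩
  · have hex := h j
    rw [HomologicalComplex.exactAt_iff' _ k j i
      (ComplexShape.prev_eq' _ hjk) (ComplexShape.next_eq' _ hij),
      ShortComplex.ab_exact_iff] at hex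
    exact hex x hx
  · rw [HomologicalComplex.exactAt_iff' _ (j + 1) j (j - 1)
      (ComplexShape.prev_eq' _ rfl) (ComplexShape.next_eq' _ (sub_add_cancel j 1)),
      ShortComplex.ab_exact_iff]
    exact fun x hx ↦ h (j - 1) j (j + 1) (by lia) rfl x hx

lemma exists_of_isZero_extGroup {M : 𝒜} (R : LeftResolution C M) {c : 𝒜} {n : ℤ}
    (h : IsZero (R.extGroup n c)) {i j k : ℤ} (hj : j = -n) (hij : i + 1 = j) (hjk : j + 1 = k)
    (x : R.complex.X j ⟶ c) (hx : R.complex.d i j ≫ x = 0) :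
    ∃ y : R.complex.X k ⟶ c, R.complex.d j k ≫ y = x := by
  subst hj
  have hex := (HomologicalComplex.exactAt_iff_isZero_homology _ _).2 h
  rw [HomologicalComplex.exactAt_iff' _ k (-n) i
      (ComplexShape.prev_eq' _ hjk) (ComplexShape.next_eq' _ hij),
    ShortComplex.ab_exact_iff] at hex
  exact hex x hx

/-- A sequence in `𝒜` which becomes short exact after applying `Hom_𝒜(c, -)` for `c` in `C`. -/
structure RelShortExact (C : ObjectProperty 𝒜) (S : ShortComplex 𝒜) : Prop where
  mono : Mono S.f
  exact : ∀ ⦃c : 𝒜⦄, C c → ∀ x : c ⟶ S.X₂, x ≫ S.g = 0 → ∃ y : c ⟶ S.X₁, y ≫ S.f = x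
  surjective : ∀ ⦃c : 𝒜⦄, C c → ∀ x : c ⟶ S.X₃, ∃ y : c ⟶ S.X₂, y ≫ S.g = x

/-- Contravariant finiteness and admissibility enter the proof only in this form: every object is a
quotient of one in C, so morphisms from C detect equality, monos, epis and exactness. -/
lemma IsAdmissible.exists_epi (hC : IsAdmissible C) (D : 𝒜) :
    ∃ (X : 𝒜) (f : X ⟶ D), C X ∧ Epi f := by
  obtain ⟨X, f, hf⟩ := hC.contravariantlyFinite D
  exact ⟨X, f, hf.1, hC.epi_of_isRightApproximation f hf⟩

lemma IsAdmissible.hom_ext (hC : IsAdmissible C) {X Y : 𝒜} {f g : X ⟶ Y}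
    (h : ∀ c, C c → ∀ x : c ⟶ X, x ≫ f = x ≫ g) : f = g := by
  obtain ⟨c, p, hc, _⟩ := hC.exists_epi X
  rw [← cancel_epi p, h c hc]

lemma IsAdmissible.mono_of_injective (hC : IsAdmissible C) {X Y : 𝒜} (f : X ⟶ Y)
    (h : ∀ c, C c → ∀ x : c ⟶ X, x ≫ f = 0 → x = 0) : Mono f :=
  Preadditive.mono_of_cancel_zero f (fun g hg ↦ hC.hom_ext fun c hc x ↦ by
    rw [comp_zero, h c hc (x ≫ g) (by rw [Category.assoc, hg, comp_zero])])

lemma IsAdmissible.epi_of_surjective (hC : IsAdmissible C) {X Y : 𝒜} (f : X ⟶ Y)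
    (h : ∀ c, C c → ∀ y : c ⟶ Y, ∃ x : c ⟶ X, x ≫ f = y) : Epi f := by
  obtain ⟨c, p, hc, _⟩ := hC.exists_epi Y
  obtain ⟨x, rfl⟩ := h c hc p
  exact epi_of_epi x f

/-- Exactness on morphisms from C forces `k` to vanish on the kernel of `g`, because C covers that
kernel. -/
lemma IsAdmissible.exists_desc (hC : IsAdmissible C) {X Y Z W : 𝒜} (f : X ⟶ Y) (g : Y ⟶ Z)
    [Epi g] (h : ∀ c, C c → ∀ y : c ⟶ Y, y ≫ g = 0 → ∃ x : c ⟶ X, x ≫ f = y)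
    (k : Y ⟶ W) (hk : f ≫ k = 0) : ∃ l : Z ⟶ W, g ≫ l = k := by
  have : kernel.ι g ≫ k = 0 := hC.hom_ext fun c hc x ↦ by
    obtain ⟨y, hy⟩ := h c hc (x ≫ kernel.ι g) (by simp)
    rw [← Category.assoc, ← hy, Category.assoc, hk, comp_zero, comp_zero]
  exact ⟨Abelian.epiDesc g k this, by simp⟩

lemma IsAdmissible.exact (hC : IsAdmissible C) (S : ShortComplex 𝒜)
    (h : ∀ c, C c → ∀ x : c ⟶ S.X₂, x ≫ S.g = 0 → ∃ y : c ⟶ S.X₁, y ≫ S.f = x) : S.Exact := by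
  rw [ShortComplex.exact_iff_epi_kernel_lift]
  refine hC.epi_of_surjective _ fun c hc y ↦ ?_
  obtain ⟨x, hx⟩ := h c hc (y ≫ kernel.ι S.g) (by simp)
  exact ⟨x, by rw [← cancel_mono (kernel.ι _)]; simpa using hx⟩

lemma IsAdmissible.acyclic (hC : IsAdmissible C) {K : CochainComplex 𝒜 ℤ}
    (hK : IsHomFromExact C K) : K.Acyclic := by
  intro j
  rw [isHomFromExact_iff] at hK
  rw [HomologicalComplex.exactAt_iff' _ (j - 1) j (j + 1) (by simp) (by simp)]
  exact hC.exact _ fun c hc x hx ↦ hK c hc (j - 1) j (j + 1) (by lia) rfl x hx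

lemma IsAdmissible.relShortExact (hC : IsAdmissible C) {S : ShortComplex 𝒜}
    (h : ∀ c, C c → (S.map (preadditiveCoyoneda.obj (op c))).ShortExact) :
    RelShortExact C S where
  mono := hC.mono_of_injective _ fun c hc x hx ↦ by
    have := (h c hc).mono_f
    exact (AddCommGrpCat.mono_iff_injective _).1 this (by
      refine Eq.trans ?_ (map_zero _).symm
      exact hx)
  exact c hc x hx := (ShortComplex.ab_exact_iff _).1 (h c hc).exact x hx
  surjective c hc x := (AddCommGrpCat.epi_iff_surjective _).1 (h c hc).epi_g x

lemma RelShortExact.shortExact_map {S : ShortComplex 𝒜} (hS : RelShortExact C S)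
    (c : 𝒜) (hc : C c) : (S.map (preadditiveCoyoneda.obj (op c))).ShortExact where
  exact := (ShortComplex.ab_exact_iff _).2 fun x hx ↦ hS.exact hc x hx
  mono_f := by
    have := hS.mono
    exact (AddCommGrpCat.mono_iff_injective _).2 fun x y h ↦ (cancel_mono S.f).1 h
  epi_g := (AddCommGrpCat.epi_iff_surjective _).2 fun x ↦ hS.surjective hc x

end Exactness

/-! ### Acyclicity of mapping cones in components. -/

section MappingCone

open CochainComplex

/-- Splits cycles and boundaries of the cone into their K- and L-components, turning later
acyclicity proofs into diagram chases. -/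
lemma isHomFromExact_mappingCone_iff {K L : CochainComplex 𝒜 ℤ} (f : K ⟶ L) :
    IsHomFromExact C (mappingCone f) ↔ ∀ c : 𝒜, C c → ∀ i j k : ℤ, i + 1 = j → j + 1 = k →
      ∀ (x : c ⟶ K.X k) (y : c ⟶ L.X j), (∀ l, k + 1 = l → x ≫ K.d k l = 0) →
        x ≫ f.f k + y ≫ L.d j k = 0 →
        ∃ (z : c ⟶ K.X j) (w : c ⟶ L.X i), z ≫ K.d j k = -x ∧
          z ≫ f.f j + w ≫ L.d i j = y := by
  rw [isHomFromExact_iff]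
  refine forall₂_congr fun c _ ↦ ⟨fun h i j k hij hjk x y hx hxy ↦ ?_,
    fun h i j k hij hjk x hx ↦ ?_⟩
  · obtain ⟨z, hz⟩ := h i j k hij hjk
      (x ≫ (mappingCone.inl f).v k j (by lia) + y ≫ (mappingCone.inr f).f j) (by
        rw [mappingCone.ext_to_iff f k (k + 1) rfl]
        constructor
        · simp [mappingCone.d_fst_v f j k (k + 1) hjk rfl, hx]
        · simpa [mappingCone.d_snd_v f j k hjk] using hxy)
    refine ⟨z ≫ (mappingCone.fst f).1.v i j hij, z ≫ (mappingCone.snd f).v i i (add_zero i),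
      ?_, ?_⟩
    · have := congr($hz ≫ (mappingCone.fst f).1.v j k hjk)
      simp [mappingCone.d_fst_v f i j k hij hjk] at this
      simp [← this]
    · have := congr($hz ≫ (mappingCone.snd f).v j j (add_zero j))
      simpa [mappingCone.d_snd_v f i j hij] using this
  · obtain ⟨z, w, h₁, h₂⟩ := h i j k hij hjk (x ≫ (mappingCone.fst f).1.v j k hjk)
      (x ≫ (mappingCone.snd f).v j j (add_zero j)) (fun l hl ↦ by
        have := congr($hx ≫ (mappingCone.fst f).1.v k l hl)
        simpa [mappingCone.d_fst_v f j k l hjk hl] using this) (by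
        have := congr($hx ≫ (mappingCone.snd f).v k k (add_zero k))
        simpa [mappingCone.d_snd_v f j k hjk] using this)
    refine ⟨z ≫ (mappingCone.inl f).v j i (by lia) + w ≫ (mappingCone.inr f).f i, ?_⟩
    rw [mappingCone.ext_to_iff f j k hjk]
    constructor
    · simp [mappingCone.d_fst_v f i j k hij hjk, h₁]
    · simpa [mappingCone.d_snd_v f i j hij] using h₂

end MappingCone

lemma distinguished_of_iso₃ {𝒯 : Type*} [Category* 𝒯] [HasZeroObject 𝒯] [HasShift 𝒯 ℤ]
    [Preadditive 𝒯] [∀ n : ℤ, (shiftFunctor 𝒯 n).Additive] [Pretriangulated 𝒯] {X Y Z Z' : 𝒯}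
    {f : X ⟶ Y} {g : Y ⟶ Z} {h : Z ⟶ X⟦(1 : ℤ)⟧} (hT : Triangle.mk f g h ∈ distTriang 𝒯)
    (e : Z ≅ Z') : Triangle.mk f (g ≫ e.hom) (e.inv ≫ h) ∈ distTriang 𝒯 :=
  isomorphic_distinguished _ hT _
    (Triangle.isoMk _ _ (Iso.refl X) (Iso.refl Y) e.symm
      (show f ≫ 𝟙 Y = 𝟙 X ≫ f by simp)
      (show (g ≫ e.hom) ≫ e.inv = 𝟙 Y ≫ g by simp)
      (show (e.inv ≫ h) ≫ (𝟙 X)⟦1⟧' = e.inv ≫ h by simp))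

/-! ### Lifting and extension in a distinguished triangle. -/

section Pretriangulated

variable {𝒯 : Type*} [Category* 𝒯] [HasZeroObject 𝒯] [HasShift 𝒯 ℤ]
    [Preadditive 𝒯] [∀ n : ℤ, (shiftFunctor 𝒯 n).Additive] [Pretriangulated 𝒯] {X Y Z W : 𝒯}
    {f : X ⟶ Y} {g : Y ⟶ Z} {h : Z ⟶ X⟦(1 : ℤ)⟧}

lemma exists_lift_of_distinguished (hT : Triangle.mk f g h ∈ distTriang 𝒯) (u : W ⟶ Y)
    (hu : u ≫ g = 0) : ∃ v : W ⟶ X, v ≫ f = u := by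
  obtain ⟨v, hv⟩ := Triangle.coyoneda_exact₂ _ hT u hu
  exact ⟨v, hv.symm⟩

lemma exists_desc_of_distinguished (hT : Triangle.mk f g h ∈ distTriang 𝒯) (u : Y ⟶ W)
    (hu : f ≫ u = 0) : ∃ v : Z ⟶ W, g ≫ v = u := by
  obtain ⟨v, hv⟩ := Triangle.yoneda_exact₂ _ hT u hu
  exact ⟨v, hv.symm⟩

lemma exists_desc_shift_of_distinguished (hT : Triangle.mk f g h ∈ distTriang 𝒯) (u : Z ⟶ W)
    (hu : g ≫ u = 0) : ∃ v : X⟦(1 : ℤ)⟧ ⟶ W, h ≫ v = u := by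
  obtain ⟨v, hv⟩ := Triangle.yoneda_exact₃ _ hT u hu
  exact ⟨v, hv.symm⟩

lemma comp_shift_eq_zero_of_distinguished (hT : Triangle.mk f g h ∈ distTriang 𝒯) :
    h ≫ f⟦(1 : ℤ)⟧' = 0 :=
  comp_distTriang_mor_zero₃₁ _ hT

lemma exists_extension_of_distinguished (hT : Triangle.mk f g h ∈ distTriang 𝒯) (u : X ⟶ W)
    (hu : h ≫ u⟦(1 : ℤ)⟧' = 0) : ∃ v : Y ⟶ W, f ≫ v = u := by
  obtain ⟨v : Y⟦(1 : ℤ)⟧ ⟶ W⟦(1 : ℤ)⟧, hv : u⟦(1 : ℤ)⟧' = (-f⟦1⟧') ≫ v⟩ :=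
    Triangle.yoneda_exact₃ _ (rot_of_distTriang _ hT) (u⟦(1 : ℤ)⟧') hu
  obtain ⟨v, rfl⟩ := (shiftFunctor 𝒯 (1 : ℤ)).map_surjective v
  exact ⟨-v, (shiftFunctor 𝒯 (1 : ℤ)).map_injective (by simp [hv])⟩

end Pretriangulated

/-! ### Chain-level representatives in the bounded homotopy category. -/

section BoundedHomotopyCategory

open CochainComplex

/-- The morphism of `K^b(𝒜)` given by a morphism of complexes. -/
def kbHom {X Y : Kb 𝒜} (f : X.obj.as ⟶ Y.obj.as) : X ⟶ Y :=
  (bounded 𝒜).homMk ((HomotopyCategory.quotient 𝒜 (.up ℤ)).map f)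

lemma kbHom_surjective {X Y : Kb 𝒜} (g : X ⟶ Y) :
    ∃ f : X.obj.as ⟶ Y.obj.as, kbHom f = g := by
  obtain ⟨f, hf⟩ := (HomotopyCategory.quotient 𝒜 (.up ℤ)).map_surjective
    (X := X.obj.as) (Y := Y.obj.as) g.hom
  exact ⟨f, by ext; exact hf⟩

lemma kbHom_comp {X Y Z : Kb 𝒜} (f : X.obj.as ⟶ Y.obj.as) (g : Y.obj.as ⟶ Z.obj.as) :
    kbHom (f ≫ g) = (kbHom f : X ⟶ Y) ≫ (kbHom g : Y ⟶ Z) := by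
  ext
  exact (HomotopyCategory.quotient 𝒜 (.up ℤ)).map_comp _ _

lemma kbHom_eq_iff {X Y : Kb 𝒜} (f g : X.obj.as ⟶ Y.obj.as) :
    (kbHom f : X ⟶ Y) = kbHom g ↔ Nonempty (Homotopy f g) := by
  refine ⟨fun h ↦ ⟨HomotopyCategory.homotopyOfEq _ _ congr(($h).hom)⟩, fun ⟨h⟩ ↦ ?_⟩
  ext
  exact HomotopyCategory.eq_of_homotopy _ _ h

/-- A bounded complex as an object of `K^b(𝒜)`. -/
def kbMk (K : CochainComplex 𝒜 ℤ) (a b : ℤ) (ha : K.IsStrictlyGE a) (hb : K.IsStrictlyLE b) :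
    Kb 𝒜 := ⟨(HomotopyCategory.quotient 𝒜 (.up ℤ)).obj K, a, b, ha, hb⟩

/-- The mapping cone of a morphism of bounded complexes, in `K^b(𝒜)`. -/
def kbCone {X Y : Kb 𝒜} (f : X.obj.as ⟶ Y.obj.as) : Kb 𝒜 :=
  ⟨(HomotopyCategory.quotient 𝒜 (.up ℤ)).obj (mappingCone f), by
    obtain ⟨a₁, b₁, _, _⟩ := X.property
    obtain ⟨a₂, b₂, _, _⟩ := Y.property
    exact bounded_mappingCone 𝒜 (K := X.obj.as) (L := Y.obj.as) f a₁ a₂ b₁ b₂⟩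

lemma exists_iso_of_distinguished {X Y Z : Kb 𝒜} {f : X ⟶ Y} {g : Y ⟶ Z} {h : Z ⟶ X⟦(1 : ℤ)⟧}
    (hT : Triangle.mk f g h ∈ distTriang (Kb 𝒜)) {Z' : HomotopyCategory 𝒜 (.up ℤ)}
    {g' : Y.obj ⟶ Z'} {h' : Z' ⟶ X.obj⟦(1 : ℤ)⟧} (hT' : Triangle.mk f.hom g' h' ∈ distTriang _) :
    ∃ e : Z.obj ≅ Z', g.hom ≫ e.hom = g' := by
  let e := isoTriangleOfIso₁₂ _ _ ((bounded 𝒜).ι.map_distinguished _ hT) hT'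
    (Iso.refl _) (Iso.refl _) (by exact (Category.comp_id _).trans (Category.id_comp _).symm)
  refine ⟨Triangle.π₃.mapIso e, ?_⟩
  have := e.hom.comm₂
  exact this.trans (Category.id_comp _)

/-- Any triangle on `kbHom f` in `Kb 𝒜` is compared, in the unbounded homotopy category, with the
standard cone triangle. The connecting morphism is left unspecified. -/
lemma exists_kbCone_distinguished {X Y : Kb 𝒜} (f : X.obj.as ⟶ Y.obj.as) :
    ∃ h : kbCone f ⟶ X⟦(1 : ℤ)⟧,
      Triangle.mk (kbHom f) (kbHom (Y := kbCone f) (mappingCone.inr f)) h ∈ distTriang (Kb 𝒜) := by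
  obtain ⟨Z, g, h, hT⟩ := distinguished_cocone_triangle (kbHom f)
  obtain ⟨e, he⟩ := exists_iso_of_distinguished hT
    (HomotopyCategory.mappingCone_triangleh_distinguished f)
  let e' : Z ≅ kbCone f := (bounded 𝒜).fullyFaithfulι.preimageIso e
  have he' : g ≫ e'.hom = kbHom (Y := kbCone f) (mappingCone.inr f) := by
    ext
    exact he
  exact ⟨e'.inv ≫ h, he' ▸ distinguished_of_iso₃ hT e'⟩

lemma trW_kbHom_iff {X Y : Kb 𝒜} (f : X.obj.as ⟶ Y.obj.as) :
    (kbRelAcyclic C).trW (kbHom f : X ⟶ Y) ↔ IsHomFromExact C (mappingCone f) := by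
  have : (kbRelAcyclic C).IsClosedUnderIsomorphisms :=
    inferInstanceAs ((relAcyclic C).inverseImage (bounded 𝒜).ι).IsClosedUnderIsomorphisms
  obtain ⟨h, hT⟩ := exists_kbCone_distinguished f
  exact (kbRelAcyclic C).trW_iff_of_distinguished _ hT

end BoundedHomotopyCategory

/-! ### Relatively exact sequences as triangles of the relative derived category. -/

section Triangle

open CochainComplex

lemma RelShortExact.of_iso {S S' : ShortComplex 𝒜} (hS : RelShortExact C S) (e : S ≅ S') :
    RelShortExact C S' where
  mono := by
    have := hS.mono
    have h : S'.f = e.inv.τ₁ ≫ S.f ≫ e.hom.τ₂ := by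
      rw [← e.hom.comm₁₂, ← Category.assoc, ← ShortComplex.comp_τ₁, e.inv_hom_id]
      simp
    rw [h]
    infer_instance
  exact c hc x hx := by
    obtain ⟨y, hy⟩ := hS.exact hc (x ≫ e.inv.τ₂) (by
      rw [Category.assoc, e.inv.comm₂₃, reassoc_of% hx, zero_comp])
    refine ⟨y ≫ e.hom.τ₁, ?_⟩
    rw [Category.assoc, e.hom.comm₁₂, reassoc_of% hy, ← ShortComplex.comp_τ₂, e.inv_hom_id]
    simp
  surjective c hc x := by
    obtain ⟨y, hy⟩ := hS.surjective hc (x ≫ e.inv.τ₃)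
    refine ⟨y ≫ e.hom.τ₂, ?_⟩
    rw [Category.assoc, e.hom.comm₂₃, reassoc_of% hy, ← ShortComplex.comp_τ₃, e.inv_hom_id]
    simp

lemma RelShortExact.map_single_eval {S : ShortComplex 𝒜} (hS : RelShortExact C S) (n : ℤ) :
    RelShortExact C ((S.map (HomologicalComplex.single 𝒜 (.up ℤ) 0)).map
      (HomologicalComplex.eval _ _ n)) := by
  by_cases hn : n = 0
  · subst hn
    exact hS.of_iso (S.mapNatIso (HomologicalComplex.singleCompEvalIsoSelf 𝒜 (.up ℤ) 0).symm)
  · have h (X : 𝒜) := HomologicalComplex.isZero_single_obj_X (.up ℤ) 0 X n hn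
    exact ⟨⟨fun _ _ _ ↦ (h _).eq_of_tgt _ _⟩, fun _ _ _ _ ↦ ⟨0, (h _).eq_of_tgt _ _⟩,
      fun _ _ _ ↦ ⟨0, (h _).eq_of_tgt _ _⟩⟩

/-- If a short complex of complexes is degreewise `Hom_𝒜(C, -)`-exact, then the comparison
morphism from the mapping cone of the first map to the third complex is a
`C`-quasi-isomorphism. -/
lemma isHomFromExact_mappingCone_descShortComplex (S : ShortComplex (CochainComplex 𝒜 ℤ))
    (hS : ∀ n, RelShortExact C (S.map (HomologicalComplex.eval _ _ n))) :
    IsHomFromExact C (mappingCone (mappingCone.descShortComplex S)) := by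
  rw [isHomFromExact_mappingCone_iff]
  intro c hc i j k hij hjk x y hx hxy
  -- A lift of `y` gives the X₂-component of the preimage. The remaining error `m` is killed by
  -- `S.g`, so it comes from X₁ through some `m'`, which supplies the X₁-component.
  obtain ⟨z₀ : c ⟶ S.X₂.X j, hz₀ : z₀ ≫ S.g.f j = y⟩ := (hS j).surjective hc y
  have hl := hx (k + 1) rfl
  set l := x ≫ (mappingCone.fst S.f).1.v k (k + 1) rfl with hl_def
  set m := x ≫ (mappingCone.snd S.f).v k k (add_zero k) + z₀ ≫ S.X₂.d j k with hm_def
  have hm : m ≫ S.g.f k = 0 := by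
    rw [mappingCone.descShortComplex, mappingCone.desc_f _ _ _ _ k (k + 1) rfl] at hxy
    simpa [hm_def, ← hz₀] using hxy
  obtain ⟨m' : c ⟶ S.X₁.X k, hm' : m' ≫ S.f.f k = m⟩ := (hS k).exact hc m hm
  -- The cycle condition gives this only after composing with `S.f`, which is monic.
  have hlm : l + m' ≫ S.X₁.d k (k + 1) = 0 := by
    have : Mono (S.f.f (k + 1)) := (hS (k + 1)).mono
    rw [← cancel_mono (S.f.f (k + 1))]
    have h := congr($hl ≫ (mappingCone.snd S.f).v (k + 1) (k + 1) (add_zero _))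
    simp [mappingCone.d_snd_v S.f k (k + 1) rfl] at h
    rw [Preadditive.add_comp, zero_comp, Category.assoc, Category.assoc, ← S.f.comm,
      reassoc_of% hm', hm_def, Preadditive.add_comp, Category.assoc, Category.assoc,
      HomologicalComplex.d_comp_d, comp_zero, add_zero]
    exact h
  refine ⟨z₀ ≫ (mappingCone.inr S.f).f j - m' ≫ (mappingCone.inl S.f).v k j (by lia), 0, ?_, ?_⟩
  · rw [mappingCone.ext_to_iff _ k (k + 1) rfl]
    constructor
    · simp [mappingCone.d_fst_v S.f j k (k + 1) hjk rfl, ← hl_def]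
      exact (neg_eq_of_add_eq_zero_right hlm).symm
    · simp [mappingCone.d_snd_v S.f j k hjk, hm', hm_def]
  · simp [mappingCone.descShortComplex, hz₀]

lemma RelShortExact.exists_distinguished [C.IsClosedUnderFiniteProducts]
    {L M N : 𝒜} {f : L ⟶ M} {g : M ⟶ N} {w : f ≫ g = 0}
    (hS : RelShortExact C (ShortComplex.mk f g w)) :
    ∃ δ : (Qb C).obj ((toKb 𝒜).obj N) ⟶ ((Qb C).obj ((toKb 𝒜).obj L))⟦(1 : ℤ)⟧,
      Triangle.mk ((Qb C).map ((toKb 𝒜).map f)) ((Qb C).map ((toKb 𝒜).map g)) δ ∈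
        distTriang (Db C) := by
  let S := ShortComplex.mk f g w
  let S' := S.map (CochainComplex.singleFunctor 𝒜 0)
  let X := (toKb 𝒜).obj S.X₁
  let Y := (toKb 𝒜).obj S.X₂
  obtain ⟨h, hT⟩ := exists_kbCone_distinguished (X := X) (Y := Y) S'.f
  let t : kbCone (X := X) (Y := Y) S'.f ⟶ (toKb 𝒜).obj S.X₃ :=
    kbHom (mappingCone.descShortComplex S')
  have ht : (kbRelAcyclic C).trW t :=
    (trW_kbHom_iff _).2 (isHomFromExact_mappingCone_descShortComplex S' hS.map_single_eval)
  let e := Localization.isoOfHom (Qb C) _ t ht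
  have h₁ := distinguished_of_iso₃ ((Qb C).map_distinguished _ hT) e
  have h₂ : (Qb C).map (kbHom (X := Y) (Y := kbCone (X := X) (Y := Y) S'.f)
      (mappingCone.inr S'.f)) ≫ e.hom = (Qb C).map ((toKb 𝒜).map g) := by
    refine ((Qb C).map_comp _ t).symm.trans (congrArg _ ?_)
    exact (kbHom_comp (Y := kbCone (X := X) (Y := Y) S'.f) _ _).symm.trans
      (congrArg _ (mappingCone.inr_descShortComplex S'))
  exact ⟨_, h₂ ▸ h₁⟩

end Triangle

/-! ### Canonical truncation of denominators. -/

section Truncation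

open CochainComplex

lemma isIso_ιTruncLE_f (K : CochainComplex 𝒜 ℤ) (n i : ℤ) (hi : i < n) :
    IsIso ((K.ιTruncLE n).f i) := by
  obtain ⟨m, rfl⟩ : ∃ m : ℕ, n - m = i := ⟨(n - i).toNat, by lia⟩
  have hm : ¬ (ComplexShape.embeddingUpIntLE n).BoundaryLE m := by
    rw [ComplexShape.boundaryLE_embeddingUpIntLE_iff]
    lia
  have : IsIso ((HomologicalComplex.πTruncGE K.op
      (ComplexShape.embeddingUpIntLE n).op).f (n - m)) := by
    exact (ComplexShape.Embedding.isIso_liftExtend_f_iff _ _ _ (i := m) rfl).2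
      (HomologicalComplex.isIso_restrictionToTruncGE' _ _ _ (by simpa using hm))
  change IsIso (((HomologicalComplex.πTruncGE K.op
    (ComplexShape.embeddingUpIntLE n).op).f (n - m)).unop)
  infer_instance

/-- A cycle is a chain map from the stalk complex on `c` in degree `n`. Truncation leaves that
complex unchanged, so naturality produces the lift. -/
lemma exists_comp_ιTruncLE_f (K : CochainComplex 𝒜 ℤ) (n : ℤ) {c : 𝒜} (x : c ⟶ K.X n)
    (hx : ∀ k, n + 1 = k → x ≫ K.d n k = 0) :
    ∃ y : c ⟶ (K.truncLE n).X n, y ≫ (K.ιTruncLE n).f n = x := by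
  let D : CochainComplex 𝒜 ℤ := (HomologicalComplex.single 𝒜 (.up ℤ) n).obj c
  let φ : D ⟶ K := HomologicalComplex.mkHomFromSingle x hx
  have h := ιTruncLE_naturality φ n
  refine ⟨(HomologicalComplex.singleObjXSelf (.up ℤ) n c).inv ≫
    (inv (D.ιTruncLE n) ≫ truncLEMap φ n).f n, ?_⟩
  rw [Category.assoc, ← HomologicalComplex.comp_f, Category.assoc, h, IsIso.inv_hom_id_assoc]
  exact (Iso.inv_comp_eq _).2 (HomologicalComplex.mkHomFromSingle_f x hx)

lemma isHomFromExact_mappingCone_ιTruncLE (K : CochainComplex 𝒜 ℤ) (n : ℤ)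
    (hK : ∀ c : 𝒜, C c → ∀ i j k : ℤ, n < j → i + 1 = j → j + 1 = k →
      ∀ x : c ⟶ K.X j, x ≫ K.d j k = 0 → ∃ y : c ⟶ K.X i, y ≫ K.d i j = x) :
    IsHomFromExact C (mappingCone (K.ιTruncLE n)) := by
  rw [isHomFromExact_mappingCone_iff]
  intro c hc i j k hij hjk x y hx hxy
  have hmono (m : ℤ) : Mono ((K.ιTruncLE n).f m) :=
    inferInstanceAs (Mono ((HomologicalComplex.ιTruncLE K _).f m))
  by_cases hj : n < j
  · obtain rfl : x = 0 := ((K.truncLE n).isZero_of_isStrictlyLE n k (by lia)).eq_of_tgt _ _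
    obtain ⟨w, hw⟩ := hK c hc i j k hj hij hjk y (by simpa using hxy)
    exact ⟨0, w, by simp, by simp [hw]⟩
  · obtain ⟨z, hz⟩ : ∃ z : c ⟶ (K.truncLE n).X j, z ≫ (K.ιTruncLE n).f j = y := by
      obtain hj | rfl := (not_lt.1 hj).lt_or_eq
      · have := isIso_ιTruncLE_f K n j hj
        exact ⟨y ≫ inv ((K.ιTruncLE n).f j), by simp⟩
      · refine exists_comp_ιTruncLE_f K j y ?_
        rintro _ rfl
        obtain rfl : x = 0 := ((K.truncLE j).isZero_of_isStrictlyLE j k (by lia)).eq_of_tgt _ _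
        subst hjk
        simpa using hxy
    refine ⟨z, 0, ?_, by simp [hz]⟩
    rw [← cancel_mono ((K.ιTruncLE n).f k), Category.assoc, ← (K.ιTruncLE n).comm,
      reassoc_of% hz, Preadditive.neg_comp]
    exact (neg_eq_of_add_eq_zero_right hxy).symm

/-- As Y vanishes above `n` and the cone of `s` is C-acyclic, Hom(c, X) is exact above `n` for c in
C. The canonical truncation of X thus has a C-acyclic cone over X. -/
lemma exists_trW_isStrictlyLE {X Y : Kb 𝒜} (n : ℤ) (hY : IsStrictlyLE Y.obj.as n) (s : X ⟶ Y)
    (hs : (kbRelAcyclic C).trW s) :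
    ∃ (X' : Kb 𝒜) (t : X' ⟶ X), IsStrictlyLE X'.obj.as n ∧ (kbRelAcyclic C).trW t := by
  obtain ⟨s, rfl⟩ := kbHom_surjective s
  obtain ⟨a, b, ha, hb⟩ := X.property
  have hs' := isHomFromExact_mappingCone_iff s |>.1 ((trW_kbHom_iff s).1 hs)
  let K : CochainComplex 𝒜 ℤ := X.obj.as
  let X' : Kb 𝒜 := kbMk (K.truncLE n) a n
    (inferInstanceAs (HomologicalComplex.IsStrictlySupported _ _)) inferInstance
  refine ⟨X', kbHom (X := X') (Y := X) (K.ιTruncLE n),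
    inferInstanceAs ((K.truncLE n).IsStrictlyLE n), ?_⟩
  refine (trW_kbHom_iff (X := X') (Y := X) (K.ιTruncLE n)).2 ?_
  refine isHomFromExact_mappingCone_ιTruncLE K n fun c hc i j k hj hij hjk x hx ↦ ?_
  obtain ⟨z, -, hz, -⟩ := hs' c hc (i - 1) i j (by lia) hij x 0 (fun l hl ↦ by
    obtain rfl : k = l := by lia
    exact hx) ((isZero_of_isStrictlyLE Y.obj.as n j (by lia)).eq_of_tgt _ _)
  exact ⟨-z, by simpa using congr(-$hz)⟩

end Truncation

/-! ### The embedding of 𝒜 into the relative derived category is fully faithful. -/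

section FullyFaithful

open CochainComplex

/-- A morphism in `D^b_C(𝒜)` from a complex in degrees `≤ n` is given by a right fraction whose
denominator starts from a complex in degrees `≤ n`. -/
lemma exists_rightFraction (C : ObjectProperty 𝒜) {X Y : Kb 𝒜} (n : ℤ)
    (hX : IsStrictlyLE X.obj.as n) (f : (Qb C).obj X ⟶ (Qb C).obj Y) :
    ∃ (Z : Kb 𝒜) (s : Z ⟶ X) (g : Z ⟶ Y), IsStrictlyLE Z.obj.as n ∧
      (kbRelAcyclic C).trW s ∧ (Qb C).map s ≫ f = (Qb C).map g := by
  obtain ⟨φ, rfl⟩ := Localization.exists_rightFraction (Qb C) (kbRelAcyclic C).trW f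
  obtain ⟨Z, t, hZ, ht⟩ := exists_trW_isStrictlyLE n hX φ.s φ.hs
  exact ⟨Z, t ≫ φ.s, t ≫ φ.f, hZ, MorphismProperty.comp_mem _ _ _ ht φ.hs, by simp⟩

lemma exists_comp_eq_zero (C : ObjectProperty 𝒜) {X Y : Kb 𝒜} (n : ℤ)
    (hX : IsStrictlyLE X.obj.as n) (f : X ⟶ Y) (hf : (Qb C).map f = 0) :
    ∃ (Z : Kb 𝒜) (s : Z ⟶ X), IsStrictlyLE Z.obj.as n ∧ (kbRelAcyclic C).trW s ∧ s ≫ f = 0 := by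
  rw [← (Qb C).map_zero, MorphismProperty.map_eq_iff_precomp (Qb C) (kbRelAcyclic C).trW] at hf
  obtain ⟨Z, s, hs, h⟩ := hf
  obtain ⟨Z', t, hZ', ht⟩ := exists_trW_isStrictlyLE n hX s hs
  exact ⟨Z', t ≫ s, hZ', MorphismProperty.comp_mem _ _ _ ht hs, by
    rw [Category.assoc, h, comp_zero, comp_zero]⟩

lemma toKb_obj_isStrictlyLE (M : 𝒜) : IsStrictlyLE ((toKb 𝒜).obj M).obj.as 0 :=
  inferInstanceAs (((CochainComplex.singleFunctor 𝒜 0).obj M).IsStrictlyLE 0)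

lemma IsAdmissible.epi_of_isHomFromExact (hC : IsAdmissible C) {K : CochainComplex 𝒜 ℤ} {M : 𝒜}
    (s : K ⟶ (HomologicalComplex.single 𝒜 (.up ℤ) 0).obj M)
    (hs : IsHomFromExact C (mappingCone s)) : Epi (s.f 0) := by
  rw [isHomFromExact_mappingCone_iff] at hs
  refine hC.epi_of_surjective _ fun c hc y ↦ ?_
  obtain ⟨z, w, -, h⟩ := hs c hc (-1) 0 1 rfl rfl 0 y (by simp) (by simp)
  exact ⟨z, by simpa using h⟩

/-- The cone condition makes `s.f 0` a cokernel of `K.d (-1) 0`, and `g.f 0` kills that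
differential. -/
lemma IsAdmissible.exists_desc_of_isHomFromExact (hC : IsAdmissible C) {K : CochainComplex 𝒜 ℤ}
    {M N : 𝒜} (s : K ⟶ (HomologicalComplex.single 𝒜 (.up ℤ) 0).obj M)
    (hK : K.IsStrictlyLE 0) (hs : IsHomFromExact C (mappingCone s))
    (g : K ⟶ (HomologicalComplex.single 𝒜 (.up ℤ) 0).obj N) :
    ∃ h : M ⟶ N, s ≫ (HomologicalComplex.single 𝒜 (.up ℤ) 0).map h = g := by
  have := hC.epi_of_isHomFromExact s hs
  rw [isHomFromExact_mappingCone_iff] at hs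
  obtain ⟨l, hl⟩ := hC.exists_desc (K.d (-1) 0) (s.f 0) (fun c hc y hy ↦ by
    obtain ⟨z, w, h, -⟩ := hs c hc (-2) (-1) 0 rfl rfl y 0
      (fun l hl ↦ (K.isZero_of_isStrictlyLE 0 l (by lia)).eq_of_tgt _ _) (by simp [hy])
    exact ⟨-z, by simp [h]⟩) (g.f 0) (by rw [← g.comm]; simp)
  refine ⟨(HomologicalComplex.singleObjXSelf (.up ℤ) 0 M).inv ≫ l ≫
    (HomologicalComplex.singleObjXSelf (.up ℤ) 0 N).hom, ?_⟩
  apply HomologicalComplex.to_single_hom_ext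
  simp [HomologicalComplex.single_map_f_self, hl]

lemma kbHom_zero (X Y : Kb 𝒜) : (kbHom 0 : X ⟶ Y) = 0 := by
  ext
  exact (HomotopyCategory.quotient 𝒜 (.up ℤ)).map_zero _ _

/-- A morphism of complexes vanishes if in each degree its source or its target does. -/
lemma kbHom_eq_zero {X Y : Kb 𝒜}
    (h : ∀ i, IsZero (X.obj.as.X i) ∨ IsZero (Y.obj.as.X i)) (f : X ⟶ Y) : f = 0 := by
  obtain ⟨f, rfl⟩ := kbHom_surjective f
  obtain rfl : f = 0 := by
    ext i
    obtain hi | hi := h i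
    exacts [hi.eq_of_src _ _, hi.eq_of_tgt _ _]
  exact kbHom_zero X Y

/-- Neither homotopy term contributes in degree `n`: one starts from K^(n+1) = 0, the other passes
through a zero differential of the stalk complex. -/
lemma f_eq_zero_of_homotopy {K : CochainComplex 𝒜 ℤ} {n : ℤ} (hK : K.IsStrictlyLE n) {N : 𝒜}
    (g : K ⟶ (HomologicalComplex.single 𝒜 (.up ℤ) n).obj N) (H : Homotopy g 0) : g.f n = 0 := by
  have h : H.hom (n + 1) n = 0 := (K.isZero_of_isStrictlyLE n (n + 1) (by lia)).eq_of_src _ _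
  rw [H.comm n, dNext_eq H.hom (show (ComplexShape.up ℤ).Rel n (n + 1) from rfl),
    prevD_eq H.hom (show (ComplexShape.up ℤ).Rel (n - 1) n from sub_add_cancel n 1), h]
  simp

lemma IsAdmissible.full (hC : IsAdmissible C) : (toKb 𝒜 ⋙ Qb C).Full where
  map_surjective {M N} f := by
    obtain ⟨Z, s, g, hZ, hs, h⟩ := exists_rightFraction C 0 (toKb_obj_isStrictlyLE M) f
    obtain ⟨s, rfl⟩ := kbHom_surjective s
    obtain ⟨g, rfl⟩ := kbHom_surjective g
    obtain ⟨l, hl⟩ := hC.exists_desc_of_isHomFromExact s hZ ((trW_kbHom_iff s).1 hs) g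
    refine ⟨l, ?_⟩
    have := Localization.inverts (Qb C) (kbRelAcyclic C).trW _ hs
    rw [← cancel_epi ((Qb C).map (kbHom s)), h]
    refine ((Qb C).map_comp _ _).symm.trans (congrArg _ ?_)
    exact (kbHom_comp (Y := (toKb 𝒜).obj M) (Z := (toKb 𝒜).obj N) _ _).symm.trans
      (congrArg _ hl)

lemma IsAdmissible.map_eq_zero (hC : IsAdmissible C) {M N : 𝒜} (f : M ⟶ N)
    (hf : (Qb C).map ((toKb 𝒜).map f) = 0) : f = 0 := by
  obtain ⟨Z, s, hZ, hs, h⟩ := exists_comp_eq_zero C 0 (toKb_obj_isStrictlyLE M) _ hf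
  obtain ⟨s, rfl⟩ := kbHom_surjective s
  have := hC.epi_of_isHomFromExact s ((trW_kbHom_iff s).1 hs)
  let φ : Z.obj.as ⟶ (HomologicalComplex.single 𝒜 (.up ℤ) 0).obj N :=
    s ≫ (HomologicalComplex.single 𝒜 (.up ℤ) 0).map f
  have hφ : (kbHom φ : Z ⟶ (toKb 𝒜).obj N) = kbHom 0 :=
    (kbHom_comp (Y := (toKb 𝒜).obj M) (Z := (toKb 𝒜).obj N) _ _).trans
      (h.trans (kbHom_zero _ _).symm)
  obtain ⟨H⟩ := (kbHom_eq_iff _ _).1 hφ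
  have h₀ : s.f 0 ≫ ((HomologicalComplex.single 𝒜 (.up ℤ) 0).map f).f 0 = 0 :=
    f_eq_zero_of_homotopy hZ φ H
  apply (HomologicalComplex.single 𝒜 (.up ℤ) 0).map_injective
  apply HomologicalComplex.to_single_hom_ext
  rw [Functor.map_zero]
  exact (this.left_cancellation _ _ (h₀.trans comp_zero.symm))

end FullyFaithful

/-! ### Vanishing of morphisms into positive shifts of C. -/

section Perp

open CochainComplex

/-- `Q` is closed under taking suitable syzygies: every object `M` of `Q` sits in a
`Hom_𝒜(C, -)`-exact sequence `0 ⟶ K ⟶ P ⟶ M ⟶ 0` with `P` in `C` and `K` in `Q`, such that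
all morphisms from `K` to an object of `C` extend to `P`. -/
def IsSyzygyClosed (C Q : ObjectProperty 𝒜) : Prop :=
  ∀ ⦃M : 𝒜⦄, Q M → ∃ (K P : 𝒜) (i : K ⟶ P) (p : P ⟶ M) (w : i ≫ p = 0),
    RelShortExact C (ShortComplex.mk i p w) ∧ C P ∧ Q K ∧
      ∀ ⦃c : 𝒜⦄, C c → ∀ f : K ⟶ c, ∃ g : P ⟶ c, i ≫ g = f

lemma kbOf_toKb [C.IsClosedUnderFiniteProducts] {c : 𝒜} (hc : C c) :
    kbOf C ((toKb 𝒜).obj c) := by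
  intro n
  change C (((HomologicalComplex.single 𝒜 (.up ℤ) 0).obj c).X n)
  by_cases hn : n = 0
  · subst hn
    exact C.prop_of_iso (HomologicalComplex.singleObjXSelf (.up ℤ) 0 c).symm hc
  · obtain ⟨Z, hZ, hZ'⟩ := C.exists_prop_of_containsZero
    exact C.prop_of_iso (hZ.iso (HomologicalComplex.isZero_single_obj_X _ _ _ _ hn)) hZ'

lemma isZero_toKb_shift (c : 𝒜) (n i : ℤ) (hi : i + n ≠ 0) :
    IsZero ((((toKb 𝒜).obj c)⟦n⟧).obj.as.X i) := by
  have e : (((toKb 𝒜).obj c)⟦n⟧).obj = (HomotopyCategory.quotient 𝒜 (.up ℤ)).obj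
      ((CategoryTheory.shiftFunctor (CochainComplex 𝒜 ℤ) n).obj ((toKb 𝒜).obj c).obj.as) :=
    Eq.trans (by with_unfolding_all rfl) (HomotopyCategory.shift_quotient_obj _ n)
  rw [e]
  exact HomologicalComplex.isZero_single_obj_X (.up ℤ) 0 c (i + n) hi

lemma exists_Qb_map_eq [C.IsClosedUnderFiniteProducts] {P Y : Kb 𝒜} (hP : kbOf C P)
    (f : (Qb C).obj P ⟶ (Qb C).obj Y) : ∃ g : P ⟶ Y, (Qb C).map g = f :=
  ((kbOf_le_leftOrthogonal C _ hP).map_bijective_of_isTriangulated (Qb C) Y).2 f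

lemma hom_shift_eq_zero_of_prop [C.IsClosedUnderFiniteProducts] {P : 𝒜} (hP : C P) (c : 𝒜) (n : ℤ)
    (hn : n ≠ 0) (f : (Qb C).obj ((toKb 𝒜).obj P) ⟶ ((Qb C).obj ((toKb 𝒜).obj c))⟦n⟧) :
    f = 0 := by
  rw [← cancel_mono (((Qb C).commShiftIso n).inv.app _), zero_comp]
  obtain ⟨g, hg⟩ := exists_Qb_map_eq (kbOf_toKb hP)
    (f ≫ ((Qb C).commShiftIso n).inv.app ((toKb 𝒜).obj c))
  rw [← hg, kbHom_eq_zero (fun i ↦ ?_) g, Functor.map_zero]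
  by_cases hi : i = 0
  · exact Or.inr (isZero_toKb_shift c n i (by lia))
  · exact Or.inl (HomologicalComplex.isZero_single_obj_X (.up ℤ) 0 P i hi)

/-- Dimension shifting along K → P → M: a morphism M → c[n+1] vanishes on P, so it comes from K[1] →
c[n+1], that is, from K → c[n]. -/
lemma IsSyzygyClosed.hom_shift_eq_zero [C.IsClosedUnderFiniteProducts] (hC : IsAdmissible C)
    {Q : ObjectProperty 𝒜} (hQ : IsSyzygyClosed C Q) {c : 𝒜} (hc : C c) (n : ℕ) :
    ∀ ⦃M : 𝒜⦄, Q M → ∀ f : (Qb C).obj ((toKb 𝒜).obj M) ⟶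
      ((Qb C).obj ((toKb 𝒜).obj c))⟦(n + 1 : ℤ)⟧, f = 0 := by
  induction n with
  | zero =>
    intro M hM f
    obtain ⟨K, P, i, p, w, hS, hP, -, hext⟩ := hQ hM
    obtain ⟨δ, hT⟩ := hS.exists_distinguished
    obtain ⟨g, rfl⟩ := exists_desc_shift_of_distinguished hT f
      (hom_shift_eq_zero_of_prop hP c _ (by simp) _)
    let e := CategoryTheory.shiftFunctorAdd' (Db C) (0 : ℤ) 1 ((0 : ℕ) + 1 : ℤ) (by simp)
    let e₀ := (shiftFunctorZero (Db C) ℤ).app ((Qb C).obj ((toKb 𝒜).obj c))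
    obtain ⟨g', hg'⟩ := (CategoryTheory.shiftFunctor (Db C) (1 : ℤ)).map_surjective
      (g ≫ e.hom.app _)
    have := hC.full
    obtain ⟨φ, hφ⟩ := (toKb 𝒜 ⋙ Qb C).map_surjective (g' ≫ e₀.hom)
    -- Here K → c is a morphism of 𝒜 and extends to P; the given morphism then factors through the
    -- composite M → K[1] → P[1], which is zero.
    obtain ⟨ψ, rfl⟩ := hext hc φ
    have h₀ := comp_shift_eq_zero_of_distinguished hT
    have hg'' : g' = (Qb C).map ((toKb 𝒜).map i) ≫ (Qb C).map ((toKb 𝒜).map ψ) ≫ e₀.inv := by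
      rw [← Category.assoc, Iso.eq_comp_inv, ← hφ]
      simp
    rw [← cancel_mono (e.hom.app _), zero_comp, Category.assoc, ← hg', hg'', Functor.map_comp,
      reassoc_of% h₀, zero_comp]
  | succ n ih =>
    intro M hM f
    obtain ⟨K, P, i, p, w, hS, hP, hK, -⟩ := hQ hM
    obtain ⟨δ, hT⟩ := hS.exists_distinguished
    obtain ⟨g, rfl⟩ := exists_desc_shift_of_distinguished hT f
      (hom_shift_eq_zero_of_prop hP c _ (by lia) _)
    let e := CategoryTheory.shiftFunctorAdd' (Db C) (n + 1 : ℤ) 1 ((n + 1 : ℕ) + 1 : ℤ)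
      (by simp)
    obtain ⟨g', hg'⟩ := (CategoryTheory.shiftFunctor (Db C) (1 : ℤ)).map_surjective (g ≫ e.hom.app _)
    rw [← cancel_mono (e.hom.app _), zero_comp, Category.assoc, ← hg', ih hK g', Functor.map_zero,
      comp_zero]

end Perp

/-! ### Removing the lowest terms of a bounded complex over C. -/

section BrutalTruncation

open CochainComplex

/-- Projection onto the lowest term is a chain map, an isomorphism in degrees ≤ a and zero above. It
is therefore degreewise split with the brutal truncation as kernel, and yields a triangle. -/
lemma exists_kb_brutal_truncation [C.IsClosedUnderFiniteProducts] {P : Kb 𝒜} (hP : kbOf C P)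
    (a d : ℤ) (had : d + a = 0) (ha : IsStrictlyGE P.obj.as a) :
    ∃ (P' Q : Kb 𝒜) (ι : P' ⟶ P) (q : P ⟶ Q) (h : Q ⟶ P'⟦(1 : ℤ)⟧) (c : 𝒜),
      Triangle.mk ι q h ∈ distTriang (Kb 𝒜) ∧ kbOf C P' ∧ IsStrictlyGE P'.obj.as (a + 1) ∧
        C c ∧ Nonempty (Q ≅ ((toKb 𝒜).obj c)⟦d⟧) := by
  let K : CochainComplex 𝒜 ℤ := P.obj.as
  obtain ⟨-, b, -, hb⟩ := P.property
  have : K.IsStrictlyGE a := ha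
  have : K.IsStrictlyLE b := hb
  let p : K ⟶ (HomologicalComplex.single 𝒜 (.up ℤ) a).obj (K.X a) :=
    HomologicalComplex.mkHomToSingle (𝟙 _) (fun i hi ↦
      (K.isZero_of_isStrictlyGE a i (by simp at hi; lia)).eq_of_src _ _)
  have hp (n : ℤ) (hn : n ≤ a) : IsIso (p.f n) := by
    obtain hn | rfl := hn.lt_or_eq
    · exact ⟨0, (K.isZero_of_isStrictlyGE a n hn).eq_of_src _ _,
        (HomologicalComplex.isZero_single_obj_X _ _ _ _ (by lia)).eq_of_src _ _⟩
    · have : p.f n = (HomologicalComplex.singleObjXSelf (.up ℤ) n (K.X n)).inv :=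
        (HomologicalComplex.mkHomToSingle_f _ _).trans (Category.id_comp _)
      rw [this]
      infer_instance
  have hz (n : ℤ) (hn : a < n) :
      IsZero (((HomologicalComplex.single 𝒜 (.up ℤ) a).obj (K.X a)).X n) :=
    HomologicalComplex.isZero_single_obj_X _ _ _ _ (by lia)
  have hepi (n : ℤ) : Epi (p.f n) := by
    by_cases hn : n ≤ a
    · have := hp n hn
      infer_instance
    · exact ⟨fun _ _ _ ↦ (hz n (by lia)).eq_of_src _ _⟩
  have : Epi p := HomologicalComplex.epi_of_epi_f _ hepi
  let S := ShortComplex.mk (kernel.ι p) p (by simp)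
  have hS : S.ShortExact :=
    { exact := ShortComplex.exact_of_f_is_kernel _ (kernelIsKernel p) }
  have hSn (n : ℤ) : (S.map (HomologicalComplex.eval _ _ n)).ShortExact := hS.map_of_exact _
  have hiso (n : ℤ) (hn : a < n) : IsIso ((kernel.ι p).f n) := (hSn n).isIso_f_iff.2 (hz n hn)
  have hzero (n : ℤ) (hn : n ≤ a) : IsZero ((kernel p).X n) := (hSn n).isIso_g_iff.1 (hp n hn)
  have σ (n : ℤ) : Nonempty (S.map (HomologicalComplex.eval _ _ n)).Splitting := by
    by_cases hn : n ≤ a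
    · have : IsIso (S.map (HomologicalComplex.eval _ _ n)).g := hp n hn
      exact ⟨.ofIsZeroOfIsIso _ (hzero n hn) this⟩
    · have : IsIso (S.map (HomologicalComplex.eval _ _ n)).f := hiso n (by lia)
      exact ⟨.ofIsIsoOfIsZero _ this (hz n (by lia))⟩
  have hT := (HomotopyCategory.distinguished_iff_iso_trianglehOfDegreewiseSplit
    (trianglehOfDegreewiseSplit S fun n ↦ (σ n).some)).2 ⟨_, _, ⟨Iso.refl _⟩⟩
  have hGE : (kernel p).IsStrictlyGE (a + 1) :=
    (isStrictlyGE_iff _ _).2 fun i hi ↦ hzero i (by lia)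
  let P' : Kb 𝒜 := kbMk (kernel p) (a + 1) b hGE ((isStrictlyLE_iff _ _).2 fun i hi ↦ by
    by_cases h : i ≤ a
    · exact hzero i h
    · have := hiso i (by lia)
      exact (K.isZero_of_isStrictlyLE b i hi).of_iso (asIso ((kernel.ι p).f i)))
  obtain ⟨Q, q, h, hT'⟩ := distinguished_cocone_triangle (kbHom (X := P') (Y := P) (kernel.ι p))
  obtain ⟨e, -⟩ := exists_iso_of_distinguished hT' hT
  refine ⟨P', Q, _, q, h, K.X a, hT', fun n ↦ ?_, hGE, hP a, ⟨?_⟩⟩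
  · by_cases hn : n ≤ a
    · obtain ⟨Z, hZ, hZ'⟩ := C.exists_prop_of_containsZero
      exact C.prop_of_iso (hZ.iso (hzero n hn)) hZ'
    · have := hiso n (by lia)
      exact C.prop_of_iso (asIso ((kernel.ι p).f n)).symm (hP n)
  · exact (bounded 𝒜).fullyFaithfulι.preimageIso (e ≪≫
      (((HomotopyCategory.singleFunctors 𝒜).shiftIso d a 0 had).app (K.X a)).symm ≪≫
      (((bounded 𝒜).ι.commShiftIso d).app ((toKb 𝒜).obj (K.X a))).symm)

lemma IsSyzygyClosed.exists_factorization [C.IsClosedUnderFiniteProducts] (hC : IsAdmissible C)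
    {Q : ObjectProperty 𝒜} (hQ : IsSyzygyClosed C Q) {M : 𝒜} (hM : Q M) (m : ℕ) :
    ∀ {P : Kb 𝒜}, kbOf C P → IsStrictlyGE P.obj.as (-m) →
      ∀ f : (Qb C).obj ((toKb 𝒜).obj M) ⟶ (Qb C).obj P,
      ∃ (P' : Kb 𝒜) (g : (Qb C).obj ((toKb 𝒜).obj M) ⟶ (Qb C).obj P') (ι : P' ⟶ P),
        kbOf C P' ∧ IsStrictlyGE P'.obj.as 0 ∧ g ≫ (Qb C).map ι = f := by
  induction m with
  | zero => exact fun {P} hP h f ↦ ⟨P, f, 𝟙 P, hP, by simpa using h, by simp⟩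
  | succ m ih =>
    intro P hP ha f
    obtain ⟨P₁, R, ι, q, h, c, hT, hP₁, ha₁, hc, ⟨e⟩⟩ := exists_kb_brutal_truncation hP _
      (m + 1 : ℤ) (by simp) ha
    -- The obstruction to lifting is the morphism from M to the lowest term, c[m+1], which vanishes.
    obtain ⟨f₁, rfl⟩ := exists_lift_of_distinguished ((Qb C).map_distinguished _ hT) f (by
      let e' := (Qb C).mapIso e ≪≫ ((Qb C).commShiftIso (m + 1 : ℤ)).app _
      exact (cancel_mono e'.hom).1 ((hQ.hom_shift_eq_zero hC hc m hM _).trans zero_comp.symm))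
    obtain ⟨P', g, ι', hP', h0, hg⟩ := ih hP₁ (by
      have : (-(m : ℤ)) = -((m + 1 : ℕ) : ℤ) + 1 := by lia
      rwa [this]) f₁
    exact ⟨P', g, ι' ≫ ι, hP', h0, by
      rw [Functor.map_comp, reassoc_of% hg]
      rfl⟩

end BrutalTruncation

/-! ### Morphisms in the C-singularity category. -/

section SingularityCategory

open CochainComplex

/-- The `P` obtained need not be the cone of `s`, but the cone morphism factors through `g`. This
suffices for the lifting and descent properties kept in the conclusion. -/
lemma exists_of_trW_dbOf [C.IsClosedUnderFiniteProducts] (hC : IsAdmissible C)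
    {Q : ObjectProperty 𝒜} (hQ : IsSyzygyClosed C Q) {M : 𝒜} (hM : Q M) {X : Db C}
    (s : X ⟶ (Qb C).obj ((toKb 𝒜).obj M)) (hs : (dbOf C).trW s) :
    ∃ (P : Kb 𝒜) (g : (Qb C).obj ((toKb 𝒜).obj M) ⟶ (Qb C).obj P),
      kbOf C P ∧ IsStrictlyGE P.obj.as 0 ∧
      (∀ ⦃W : Db C⦄ (t : W ⟶ (Qb C).obj ((toKb 𝒜).obj M)), t ≫ g = 0 → ∃ a : W ⟶ X, a ≫ s = t) ∧
      (∀ ⦃W : Db C⦄ (t : (Qb C).obj ((toKb 𝒜).obj M) ⟶ W), s ≫ t = 0 →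
        ∃ a : (Qb C).obj P ⟶ W, g ≫ a = t) := by
  obtain ⟨Z, p, δ, hT, P₀, hP₀, ⟨e⟩⟩ := hs
  obtain ⟨a, b, ha, hb⟩ := P₀.property
  have ha' : IsStrictlyGE P₀.obj.as (-(a.natAbs : ℤ)) :=
    CochainComplex.isStrictlyGE_of_ge P₀.obj.as _ a (by lia)
  obtain ⟨P, g, ι, hP, hP', hg⟩ := hQ.exists_factorization hC hM a.natAbs hP₀ ha' (p ≫ e.inv)
  have hp : p = g ≫ (Qb C).map ι ≫ e.hom := by
    rw [← Category.assoc, hg, Category.assoc, e.inv_hom_id, Category.comp_id]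
  refine ⟨P, g, hP, hP', fun W t ht ↦ exists_lift_of_distinguished hT t ?_, fun W t ht ↦ ?_⟩
  · rw [hp, reassoc_of% ht, zero_comp]
  · obtain ⟨v, rfl⟩ := exists_desc_of_distinguished hT t ht
    exact ⟨(Qb C).map ι ≫ e.hom ≫ v, by rw [hp]; simp⟩

lemma dbOf_Qb_obj (C : ObjectProperty 𝒜) [C.IsClosedUnderFiniteProducts] {P : Kb 𝒜}
    (hP : kbOf C P) : dbOf C ((Qb C).obj P) :=
  ⟨P, hP, ⟨Iso.refl _⟩⟩

/-- The morphism comes from `Kb 𝒜`, where P sits in degrees ≥ 0 and N[1] in degree -1. -/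
lemma hom_shift_eq_zero_of_isStrictlyGE [C.IsClosedUnderFiniteProducts] {P : Kb 𝒜}
    (hP : kbOf C P) (hP' : IsStrictlyGE P.obj.as 0) (N : 𝒜)
    (f : (Qb C).obj P ⟶ ((Qb C).obj ((toKb 𝒜).obj N))⟦(1 : ℤ)⟧) : f = 0 := by
  rw [← cancel_mono (((Qb C).commShiftIso (1 : ℤ)).inv.app _), zero_comp]
  obtain ⟨g, hg⟩ := exists_Qb_map_eq hP
    (f ≫ ((Qb C).commShiftIso (1 : ℤ)).inv.app ((toKb 𝒜).obj N))
  rw [← hg, kbHom_eq_zero (fun i ↦ ?_) g, Functor.map_zero]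
  by_cases hi : i < 0
  · exact Or.inl (isZero_of_isStrictlyGE P.obj.as 0 i hi)
  · exact Or.inr (isZero_toKb_shift N 1 i (by lia))

lemma IsSyzygyClosed.toDsg_map_surjective [C.IsClosedUnderFiniteProducts] (hC : IsAdmissible C)
    {Q : ObjectProperty 𝒜} (hQ : IsSyzygyClosed C Q) {M : 𝒜} (hM : Q M) (N : 𝒜) :
    Function.Surjective ((toDsg C).map : (M ⟶ N) → _) := by
  intro f
  obtain ⟨φ, hφ⟩ := Localization.exists_rightFraction (Qsg C) (dbOf C).trW
    (X := (Qb C).obj ((toKb 𝒜).obj M)) (Y := (Qb C).obj ((toKb 𝒜).obj N)) f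
  obtain ⟨P, g, hP, hP', hlift, -⟩ := exists_of_trW_dbOf hC hQ hM φ.s φ.hs
  -- The denominator `φ.s` is replaced by `t`, which factors through it and has cone `P` in degrees
  -- ≥ 0. The numerator then extends along `t`.
  obtain ⟨X, t, δ, hT⟩ := distinguished_cocone_triangle₁ g
  obtain ⟨a, ha⟩ := hlift t (comp_distTriang_mor_zero₁₂ _ hT)
  obtain ⟨l, hl⟩ := exists_extension_of_distinguished hT (a ≫ φ.f)
    (hom_shift_eq_zero_of_isStrictlyGE hP hP' N _)
  have := hC.full
  obtain ⟨l, rfl⟩ := (toKb 𝒜 ⋙ Qb C).map_surjective l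
  refine ⟨l, ?_⟩
  have ht : (dbOf C).trW t := ⟨_, _, _, hT, dbOf_Qb_obj C hP⟩
  have := Localization.inverts (Qsg C) (dbOf C).trW _ ht
  rw [← cancel_epi ((Qsg C).map t)]
  refine ((Qsg C).map_comp t _).symm.trans ((congrArg _ hl).trans ?_)
  rw [hφ, ← ha]
  simp

lemma exists_comp_single_map_eq {K : CochainComplex 𝒜 ℤ} {n : ℤ} (hK : K.IsStrictlyGE n) {N : 𝒜}
    (φ : K ⟶ (HomologicalComplex.single 𝒜 (.up ℤ) n).obj N) :
    ∃ (r : K ⟶ (HomologicalComplex.single 𝒜 (.up ℤ) n).obj (K.X n)) (b : K.X n ⟶ N),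
      r ≫ (HomologicalComplex.single 𝒜 (.up ℤ) n).map b = φ := by
  refine ⟨HomologicalComplex.mkHomToSingle (𝟙 _) (fun i hi ↦
      (K.isZero_of_isStrictlyGE n i (by simp at hi; lia)).eq_of_src _ _),
    φ.f n ≫ (HomologicalComplex.singleObjXSelf (.up ℤ) n N).hom, ?_⟩
  apply HomologicalComplex.to_single_hom_ext
  rw [HomologicalComplex.comp_f, HomologicalComplex.mkHomToSingle_f,
    HomologicalComplex.single_map_f_self]
  simp

lemma IsSyzygyClosed.mem_factoring [C.IsClosedUnderFiniteProducts] (hC : IsAdmissible C)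
    {Q : ObjectProperty 𝒜} (hQ : IsSyzygyClosed C Q) {M : 𝒜} (hM : Q M) {N : 𝒜} (f : M ⟶ N)
    (hf : (toDsg C).map f = 0) : f ∈ factoring C M N := by
  have hf' : (Qsg C).map ((Qb C).map ((toKb 𝒜).map f)) = (Qsg C).map 0 :=
    hf.trans ((Qsg C).map_zero _ _).symm
  rw [MorphismProperty.map_eq_iff_precomp (Qsg C) (dbOf C).trW] at hf'
  obtain ⟨X, s, hs, h⟩ := hf'
  obtain ⟨P, g, hP, hP', -, hdesc⟩ := exists_of_trW_dbOf hC hQ hM s hs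
  obtain ⟨a, ha⟩ := hdesc _ (h.trans comp_zero)
  obtain ⟨a, rfl⟩ := exists_Qb_map_eq hP a
  obtain ⟨φ, rfl⟩ := kbHom_surjective a
  let K : CochainComplex 𝒜 ℤ := P.obj.as
  -- With no terms of P below degree 0, the projection onto P^0 is a chain map, and P → N factors
  -- through it.
  obtain ⟨r, b, hr⟩ := exists_comp_single_map_eq (K := K) hP' φ
  have hr' : (Qb C).map (kbHom (X := P) (Y := (toKb 𝒜).obj (K.X 0)) r) ≫
      (Qb C).map ((toKb 𝒜).map b) = (Qb C).map (kbHom φ) :=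
    ((Qb C).map_comp _ _).symm.trans (congrArg _
      ((kbHom_comp (Y := (toKb 𝒜).obj (K.X 0)) (Z := (toKb 𝒜).obj N) _ _).symm.trans
        (congrArg _ hr)))
  have := hC.full
  obtain ⟨β, hβ⟩ := (toKb 𝒜 ⋙ Qb C).map_surjective
    (g ≫ (Qb C).map (kbHom (X := P) (Y := (toKb 𝒜).obj (K.X 0)) r))
  refine ⟨K.X 0, β, b, hP 0, ?_⟩
  rw [← sub_eq_zero]
  apply hC.map_eq_zero
  rw [Functor.map_sub, Functor.map_sub, sub_eq_zero, ← ha, ← hr', Functor.map_comp,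
    Functor.map_comp, ← Category.assoc, ← hβ]
  rfl

lemma isZero_toDsg_obj [C.IsClosedUnderFiniteProducts] {c : 𝒜} (hc : C c) :
    IsZero ((toDsg C).obj c) := by
  let z : (0 : Db C) ⟶ (Qb C).obj ((toKb 𝒜).obj c) := 0
  have h : (dbOf C).trW z :=
    ⟨_, _, _, contractible_distinguished₁ _, dbOf_Qb_obj C (kbOf_toKb hc)⟩
  have := Localization.inverts (Qsg C) (dbOf C).trW _ h
  exact ((Qsg C).map_isZero (isZero_zero (Db C))).of_iso (asIso ((Qsg C).map z)).symm

lemma toDsg_map_eq_zero [C.IsClosedUnderFiniteProducts] {M N : 𝒜} {f : M ⟶ N}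
    (hf : f ∈ factoring C M N) : (toDsg C).map f = 0 := by
  obtain ⟨c, a, b, hc, rfl⟩ := hf
  rw [Functor.map_comp, (isZero_toDsg_obj hc).eq_of_tgt ((toDsg C).map a) 0, zero_comp]

instance [C.IsClosedUnderFiniteProducts] : (toDsg C).Additive :=
  inferInstanceAs (toKb 𝒜 ⋙ Qb C ⋙ Qsg C).Additive

lemma IsSyzygyClosed.exists_addEquiv [C.IsClosedUnderFiniteProducts] (hC : IsAdmissible C)
    {Q : ObjectProperty 𝒜} (hQ : IsSyzygyClosed C Q) {M : 𝒜} (hM : Q M) (N : 𝒜) :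
    ∃ e : (M ⟶ N) ⧸ factoring C M N ≃+ ((toDsg C).obj M ⟶ (toDsg C).obj N),
      ∀ f : M ⟶ N, e (QuotientAddGroup.mk f) = (toDsg C).map f := by
  let φ : (M ⟶ N) →+ ((toDsg C).obj M ⟶ (toDsg C).obj N) := (toDsg C).mapAddHom
  have hφ : factoring C M N = φ.ker :=
    le_antisymm (fun f hf ↦ toDsg_map_eq_zero hf) (fun f hf ↦ hQ.mem_factoring hC hM f hf)
  exact ⟨(QuotientAddGroup.quotientAddEquivOfEq hφ).trans
    (QuotientAddGroup.quotientKerEquivOfSurjective φ (hQ.toDsg_map_surjective hC hM N)),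
    fun f ↦ rfl⟩

end SingularityCategory

/-! ### Syzygy classes from relatively acyclic complexes and left resolutions. -/

section Syzygies

open CochainComplex

/-- The sequence `0 ⟶ ker d ⟶ K ^ i ⟶ ker d ⟶ 0` attached to a complex `K`, composed with an
isomorphism from its last term. -/
lemma relShortExact_kernel {K : CochainComplex 𝒜 ℤ} (hK : IsHomFromExact C K) {i j k : ℤ}
    (hij : i + 1 = j) (hjk : j + 1 = k) {M : 𝒜} (e : M ≅ kernel (K.d j k)) :
    RelShortExact C (ShortComplex.mk (kernel.ι (K.d i j))
      (kernel.lift (K.d j k) (K.d i j) (K.d_comp_d _ _ _) ≫ e.inv) (by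
        rw [← Category.assoc, ← cancel_mono e.hom, ← cancel_mono (kernel.ι (K.d j k))]
        simp)) where
  mono := inferInstanceAs (Mono (kernel.ι _))
  exact c hc x hx := by
    refine ⟨kernel.lift _ x ?_, kernel.lift_ι _ _ _⟩
    have := congr($hx ≫ e.hom ≫ kernel.ι (K.d j k))
    simpa using this
  surjective c hc x := by
    obtain ⟨y, hy⟩ := isHomFromExact_iff.1 hK c hc i j k hij hjk (x ≫ e.hom ≫ kernel.ι _)
      (by simp)
    refine ⟨y, ?_⟩
    rw [← cancel_mono e.hom, ← cancel_mono (kernel.ι (K.d j k))]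
    simpa using hy

/-- Precomposing `f` with the epi from `K.X i` onto the cycles gives a morphism killed by the
previous differential. Its factorization through `K.d i j` extends `f`. -/
lemma IsAdmissible.exists_extension (hC : IsAdmissible C) {K : CochainComplex 𝒜 ℤ}
    (hK : IsHomFromExact C K) {i j k : ℤ} (hij : i + 1 = j) (hjk : j + 1 = k) {c : 𝒜}
    (h : ∀ x : K.X i ⟶ c, K.d (i - 1) i ≫ x = 0 → ∃ y : K.X j ⟶ c, K.d i j ≫ y = x)
    (f : kernel (K.d j k) ⟶ c) : ∃ g : K.X j ⟶ c, kernel.ι (K.d j k) ≫ g = f := by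
  let p := kernel.lift (K.d j k) (K.d i j) (K.d_comp_d _ _ _)
  have hp : p ≫ kernel.ι _ = K.d i j := kernel.lift_ι _ _ _
  have : Epi p := hC.epi_of_surjective _ fun c hc x ↦ by
    obtain ⟨y, hy⟩ := isHomFromExact_iff.1 hK c hc i j k hij hjk (x ≫ kernel.ι _) (by simp)
    exact ⟨y, by rw [← cancel_mono (kernel.ι (K.d j k)), Category.assoc, hp, hy]⟩
  obtain ⟨y, hy⟩ := h (p ≫ f) (by
    have : K.d (i - 1) i ≫ p = 0 := by
      rw [← cancel_mono (kernel.ι (K.d j k)), Category.assoc, hp]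
      simp
    rw [reassoc_of% this, zero_comp])
  refine ⟨y, ?_⟩
  rw [← cancel_epi p, ← Category.assoc, hp, hy]

/-- The bound `m` accommodates augmented resolutions, whose degree 0 term M need not lie in C. -/
lemma IsAdmissible.isSyzygyClosed_kernel (hC : IsAdmissible C) {K : CochainComplex 𝒜 ℤ}
    (hK : IsHomFromExact C K) (m : ℤ) (hmem : ∀ n < m, C (K.X n))
    (hext : ∀ ⦃c : 𝒜⦄, C c → ∀ i j : ℤ, i + 1 = j → j < m → ∀ x : K.X i ⟶ c,
      K.d (i - 1) i ≫ x = 0 → ∃ y : K.X j ⟶ c, K.d i j ≫ y = x) :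
    IsSyzygyClosed C (fun M ↦ ∃ n ≤ m, Nonempty (M ≅ kernel (K.d n (n + 1)))) := by
  rintro M ⟨n, hn, ⟨e⟩⟩
  obtain ⟨i, rfl⟩ : ∃ i, i + 1 = n := ⟨n - 1, by lia⟩
  exact ⟨_, _, _, _, _, relShortExact_kernel hK rfl rfl e, hmem i (by lia),
    ⟨i, by lia, ⟨Iso.refl _⟩⟩, fun c hc f ↦ hC.exists_extension hK (sub_add_cancel i 1) rfl
      (hext hc (i - 1) i (by lia) (by lia)) f⟩

/-- The functor Hom(c, -) commutes with mapping cones, and a quasi-isomorphism has an acyclic cone.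
-/
lemma isHomFromExact_mappingCone_of_isRelQuasiIso {K L : CochainComplex 𝒜 ℤ} {f : K ⟶ L}
    (hf : IsRelQuasiIso C f) : IsHomFromExact C (mappingCone f) := by
  intro c hc n
  let F := preadditiveCoyoneda.obj (op c)
  have h₁ : (HomotopyCategory.subcategoryAcyclic AddCommGrpCat.{v}).trW
      ((HomotopyCategory.quotient _ _).map ((F.mapHomologicalComplex (.up ℤ)).map f)) := by
    rw [← HomotopyCategory.quasiIso_eq_trW_subcategoryAcyclic,
      HomotopyCategory.quotient_map_mem_quasiIso_iff]
    exact hf c hc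
  have h₂ := (HomotopyCategory.quotient_obj_mem_subcategoryAcyclic_iff_acyclic _).1
    (((HomotopyCategory.subcategoryAcyclic AddCommGrpCat.{v}).trW_iff_of_distinguished _
      (HomotopyCategory.mappingCone_triangleh_distinguished
        ((F.mapHomologicalComplex (.up ℤ)).map f))).1 h₁)
  exact (h₂ n).of_iso (mappingCone.mapHomologicalComplexIso f F).symm

lemma mappingCone_X_prop [C.IsClosedUnderFiniteProducts] {K L : CochainComplex 𝒜 ℤ} (f : K ⟶ L)
    (n : ℤ) (h₁ : C (K.X (n + 1))) (h₂ : C (L.X n)) : C ((mappingCone f).X n) :=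
  C.prop_of_iso (HomologicalComplex.homotopyCofiber.XIsoBiprod f n (n + 1) rfl).symm
    (prop_biprod C h₁ h₂)

lemma prop_of_isZero [C.IsClosedUnderFiniteProducts] {X : 𝒜} (hX : IsZero X) : C X := by
  obtain ⟨Z, hZ, hZ'⟩ := C.exists_prop_of_containsZero
  exact C.prop_of_iso (hZ.iso hX) hZ'

/-- The cycles in degree `0` of the mapping cone of a morphism to a complex concentrated in
degree `0`, when the source vanishes in positive degrees. -/
lemma nonempty_iso_kernel_mappingCone {K : CochainComplex 𝒜 ℤ} {M : 𝒜}
    (f : K ⟶ (HomologicalComplex.single 𝒜 (.up ℤ) 0).obj M) (hK : K.IsStrictlyLE 0) :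
    Nonempty (M ≅ kernel ((mappingCone f).d 0 (0 + 1))) := by
  have h₁ : IsZero ((mappingCone f).X (0 + 1)) := (mappingCone.isZero_X_iff _ _).2
    ⟨K.isZero_of_isStrictlyLE 0 _ (by lia),
      HomologicalComplex.isZero_single_obj_X _ _ _ _ (by lia)⟩
  have h₂ : (mappingCone.inr f).f 0 ≫ (mappingCone.snd f).v 0 0 (add_zero 0) = 𝟙 _ := by simp
  have h₃ : (mappingCone.snd f).v 0 0 (add_zero 0) ≫ (mappingCone.inr f).f 0 = 𝟙 _ := by
    have := mappingCone.id_X f 0 1 rfl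
    rwa [(K.isZero_of_isStrictlyLE 0 1 (by lia)).eq_of_tgt ((mappingCone.fst f).1.v 0 1 rfl) 0,
      zero_comp, zero_add] at this
  have : IsIso (kernel.ι ((mappingCone f).d 0 (0 + 1))) := by
    rw [h₁.eq_of_tgt ((mappingCone f).d 0 (0 + 1)) 0]
    infer_instance
  exact ⟨(HomologicalComplex.singleObjXSelf (.up ℤ) 0 M).symm ≪≫ ⟨_, _, h₂, h₃⟩ ≪≫
    (asIso (kernel.ι ((mappingCone f).d 0 (0 + 1)))).symm⟩

lemma leftPerp.exists_isSyzygyClosed [C.IsClosedUnderFiniteProducts] (hC : IsAdmissible C) {M : 𝒜}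
    (hM : leftPerp C M) : ∃ Q : ObjectProperty 𝒜, IsSyzygyClosed C Q ∧ Q M := by
  obtain ⟨R, hR⟩ := hM
  have := R.isStrictlyLE
  let E := mappingCone R.π
  have hz (n : ℤ) (hn : n < 0) : IsZero (((CochainComplex.singleFunctor 𝒜 0).obj M).X n) :=
    HomologicalComplex.isZero_single_obj_X _ _ _ _ (by lia)
  refine ⟨_, hC.isSyzygyClosed_kernel
    (isHomFromExact_mappingCone_of_isRelQuasiIso R.isRelQuasiIso) 0
    (fun n hn ↦ mappingCone_X_prop _ n (R.mem _) (prop_of_isZero (hz n hn))) ?_,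
    0, le_rfl, nonempty_iso_kernel_mappingCone R.π R.isStrictlyLE⟩
  intro c hc i j hij hj x hx
  -- In negative degrees the cone is the resolution moved by one: degree `i` of the cone is degree
  -- `j = i + 1` of `R.complex`, so exactness there is the vanishing of Ext^(-j). The sign of the
  -- cone differential explains the minus in the witness below.
  obtain ⟨y, hy⟩ := exists_of_isZero_extGroup R (hR c hc (-j) (by lia)) (i := i) (j := j)
    (k := j + 1) (by simp) hij rfl ((mappingCone.inl R.π).v j i (by lia) ≫ x) (by
      have := congr((mappingCone.inl R.π).v i (i - 1) (by lia) ≫ $hx)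
      rw [← Category.assoc, mappingCone.inl_v_d R.π i (i - 1) j (by lia) (by lia),
        (hz i (by lia)).eq_of_tgt (R.π.f i) 0] at this
      simpa using this)
  refine ⟨-(mappingCone.fst R.π).1.v j (j + 1) rfl ≫ y, ?_⟩
  rw [mappingCone.ext_from_iff _ j i hij]
  refine ⟨?_, (hz i (by lia)).eq_of_src _ _⟩
  rw [Preadditive.comp_neg, ← Category.assoc, mappingCone.d_fst_v R.π i j (j + 1) hij rfl]
  simp [hy]

end Syzygies

/-! ### The Gorenstein category, its projective-injectives and its stable category. -/

section Gorenstein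

open CochainComplex

/-- The complex `K` with its degrees translated by `n`, without change of signs. -/
@[simps]
def translate (K : CochainComplex 𝒜 ℤ) (n : ℤ) : CochainComplex 𝒜 ℤ where
  X i := K.X (i + n)
  d i j := K.d (i + n) (j + n)
  shape i j hij := K.shape _ _ (fun h ↦ hij (by simp at h ⊢; lia))

lemma nonempty_image_iso_kernel {K : CochainComplex 𝒜 ℤ} (hK : K.Acyclic) {i j k : ℤ}
    (hij : i + 1 = j) (hjk : j + 1 = k) : Nonempty (image (K.d i j) ≅ kernel (K.d j k)) := by
  have h := hK j
  rw [HomologicalComplex.exactAt_iff' _ i j k (by simp; lia) (by simp; lia),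
    ShortComplex.exact_iff_epi_kernel_lift] at h
  have : StrongEpi (kernel.lift (K.d j k) (K.d i j) (K.d_comp_d _ _ _)) :=
    have : Epi (kernel.lift (K.d j k) (K.d i j) (K.d_comp_d _ _ _)) := h
    strongEpi_of_epi _
  exact ⟨(image.isoStrongEpiMono _ (kernel.ι (K.d j k)) (kernel.lift_ι _ _ _)).symm⟩

/-- Acyclicity may be dropped because it follows from Hom(C, -)-exactness, and it identifies the
image with the next kernel. -/
lemma gorenstein_iff (hC : IsAdmissible C) (M : 𝒜) :
    gorenstein C M ↔ ∃ K : CochainComplex 𝒜 ℤ, (∀ n : ℤ, C (K.X n)) ∧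
      IsHomFromExact C K ∧ IsHomToExact C K ∧ Nonempty (M ≅ kernel (K.d 0 1)) := by
  constructor
  · rintro ⟨K, hK, hac, h₁, h₂, ⟨e⟩⟩
    obtain ⟨e'⟩ := nonempty_image_iso_kernel hac (show (-1 : ℤ) + 1 = 0 from rfl) (zero_add 1)
    exact ⟨K, hK, h₁, h₂, ⟨e ≪≫ e'⟩⟩
  · rintro ⟨K, hK, h₁, h₂, ⟨e⟩⟩
    obtain ⟨e'⟩ := nonempty_image_iso_kernel (hC.acyclic h₁) (show (-1 : ℤ) + 1 = 0 from rfl)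
      (zero_add 1)
    exact ⟨K, hK, hC.acyclic h₁, h₁, h₂, ⟨e ≪≫ e'.symm⟩⟩

lemma isSyzygyClosed_gorenstein (hC : IsAdmissible C) : IsSyzygyClosed C (gorenstein C) := by
  intro M hM
  obtain ⟨K, hK, h₁, h₂, ⟨e⟩⟩ := (gorenstein_iff hC M).1 hM
  refine ⟨_, _, _, _, _, relShortExact_kernel h₁ (show (-1 : ℤ) + 1 = 0 from rfl) (zero_add 1) e,
    hK _, (gorenstein_iff hC _).2 ⟨translate K (-1), fun n ↦ hK _, ?_, ?_, ⟨Iso.refl _⟩⟩,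
    fun c hc f ↦ hC.exists_extension h₁ (show (-2 : ℤ) + 1 = -1 from rfl) rfl
      (isHomToExact_iff.1 h₂ c hc _ _ _ rfl rfl) f⟩
  · exact isHomFromExact_iff.2 fun c hc i j k hij hjk ↦
      isHomFromExact_iff.1 h₁ c hc (i + -1) (j + -1) (k + -1) (by lia) (by lia)
  · exact isHomToExact_iff.2 fun c hc i j k hij hjk ↦
      isHomToExact_iff.1 h₂ c hc (i + -1) (j + -1) (k + -1) (by lia) (by lia)

lemma isHomFromExact_mappingCone_id (K : CochainComplex 𝒜 ℤ) :
    IsHomFromExact C (mappingCone (𝟙 K)) :=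
  (isHomFromExact_mappingCone_iff _).2 fun c _ i j k _ _ x y _ hxy ↦
    ⟨y, 0, (neg_eq_of_add_eq_zero_right (by simpa using hxy)).symm, by simp⟩

lemma isHomToExact_mappingCone_id (K : CochainComplex 𝒜 ℤ) :
    IsHomToExact C (mappingCone (𝟙 K)) := by
  refine isHomToExact_iff.2 fun c _ i j k hij hjk x hx ↦
    ⟨(mappingCone.snd (𝟙 K)).v k k (add_zero k) ≫ (mappingCone.inl (𝟙 K)).v k j (by lia) ≫ x, ?_⟩
  have h := congr((mappingCone.inl (𝟙 K)).v j i (by lia) ≫ $hx)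
  rw [← Category.assoc, mappingCone.inl_v_d (𝟙 K) j i k (by lia) (by lia),
    Preadditive.sub_comp, comp_zero, sub_eq_zero] at h
  rw [mappingCone.ext_from_iff _ k j hjk]
  constructor
  · simp [← Category.assoc, mappingCone.d_snd_v (𝟙 K) j k hjk]
  · rw [← Category.assoc, mappingCone.inr_f_d]
    simpa using h.symm

/-- The complete resolution is the contractible complex with `c` in degrees -1 and 0, realized as
the cone of an identity. -/
lemma gorenstein_of_prop [C.IsClosedUnderFiniteProducts] (hC : IsAdmissible C) {c : 𝒜}
    (hc : C c) : gorenstein C c :=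
  (gorenstein_iff hC c).2 ⟨mappingCone (𝟙 ((HomologicalComplex.single 𝒜 (.up ℤ) 0).obj c)),
    fun n ↦ mappingCone_X_prop _ n (kbOf_toKb hc _) (kbOf_toKb hc _),
    isHomFromExact_mappingCone_id _, isHomToExact_mappingCone_id _,
    nonempty_iso_kernel_mappingCone _ inferInstance⟩

/-- The syzygy sequence ending in P is a conflation with middle term in C; projectivity splits it.
-/
lemma prop_of_isConflationProjective [C.IsClosedUnderFiniteProducts] [C.IsStableUnderRetracts]
    (hC : IsAdmissible C) {P : (gorenstein C).FullSubcategory}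
    (hP : IsConflationProjective C P) : C P.obj := by
  obtain ⟨K, P₀, i, p, w, hS, hP₀, hK, -⟩ := isSyzygyClosed_gorenstein hC P.property
  let S : ShortComplex (gorenstein C).FullSubcategory :=
    ShortComplex.mk (X₁ := ⟨K, hK⟩) (X₂ := ⟨P₀, gorenstein_of_prop hC hP₀⟩) (X₃ := P)
      ((gorenstein C).homMk i) ((gorenstein C).homMk p) (by ext; exact w)
  obtain ⟨g, hg⟩ := hP S (fun c hc ↦ hS.shortExact_map c hc) (𝟙 P)
  exact C.prop_of_retract ⟨g.hom, p, congr(($hg).hom)⟩ hP₀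

lemma isConflationProjective_of_prop {P : (gorenstein C).FullSubcategory} (hC : IsAdmissible C)
    (hP : C P.obj) : IsConflationProjective C P := by
  intro S hS f
  obtain ⟨g, hg⟩ := (hC.relShortExact hS).surjective hP f.hom
  exact ⟨(gorenstein C).homMk g, by ext; exact hg⟩

/-- The conflation becomes a triangle in `Db C`, where the obstruction to extending is a morphism X₃
→ I[1], hence zero. Full faithfulness brings the extension back to 𝒜. -/
lemma isConflationInjective_of_prop [C.IsClosedUnderFiniteProducts]
    {I : (gorenstein C).FullSubcategory} (hC : IsAdmissible C)
    (hI : C I.obj) : IsConflationInjective C I := by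
  intro S hS f
  obtain ⟨δ, hT⟩ := (hC.relShortExact hS).exists_distinguished
  obtain ⟨v, hv⟩ := exists_extension_of_distinguished hT ((Qb C).map ((toKb 𝒜).map f.hom))
    (by simpa using (isSyzygyClosed_gorenstein hC).hom_shift_eq_zero hC hI 0 S.X₃.property _)
  have := hC.full
  obtain ⟨g, rfl⟩ := (toKb 𝒜 ⋙ Qb C).map_surjective v
  refine ⟨(gorenstein C).homMk g, ?_⟩
  ext
  rw [← sub_eq_zero]
  apply hC.map_eq_zero
  rw [Functor.map_sub, Functor.map_sub, sub_eq_zero, ← hv]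
  exact ((toKb 𝒜 ⋙ Qb C).map_comp _ _)

/-- Both sides say that the difference of `f` and `g` factors through an object of C. -/
lemma stableRel_iff [C.IsClosedUnderFiniteProducts] [C.IsStableUnderRetracts]
    (hC : IsAdmissible C) {X Y : (gorenstein C).FullSubcategory} (f g : X ⟶ Y) :
    stableRel C f g ↔ (theta C).map f = (theta C).map g := by
  have h : (theta C).map f = (theta C).map g ↔ f.hom - g.hom ∈ factoring C X.obj Y.obj := by
    rw [← sub_eq_zero]
    refine Iff.trans ?_ ⟨(isSyzygyClosed_gorenstein hC).mem_factoring hC X.property _,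
      toDsg_map_eq_zero⟩
    rw [Functor.map_sub]
    rfl
  rw [h]
  constructor
  · rintro ⟨P, a, b, hP, -, hab⟩
    exact ⟨P.obj, a.hom, b.hom, prop_of_isConflationProjective hC hP, congr(($hab).hom).symm⟩
  · rintro ⟨c, a, b, hc, hab⟩
    let P : (gorenstein C).FullSubcategory := ⟨c, gorenstein_of_prop hC hc⟩
    refine ⟨P, (gorenstein C).homMk a, (gorenstein C).homMk b,
      isConflationProjective_of_prop hC hc, isConflationInjective_of_prop hC hc, ?_⟩
    ext
    exact hab.symm

theorem exists_stable_functor [C.IsClosedUnderFiniteProducts] [C.IsStableUnderRetracts]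
    (hC : IsAdmissible C) :
    ∃ θ' : StableGorenstein C ⥤ Dsg C, toStable C ⋙ θ' = theta C ∧ θ'.Full ∧ θ'.Faithful := by
  let θ' : StableGorenstein C ⥤ Dsg C :=
    CategoryTheory.Quotient.lift (stableRel C) (theta C) fun _ _ f g h ↦ (stableRel_iff hC f g).1 h
  have hθ : toStable C ⋙ θ' = theta C := CategoryTheory.Quotient.lift_spec _ _ _
  refine ⟨θ', hθ, ⟨fun {X Y} f ↦ ?_⟩, ⟨fun {X Y} f g h ↦ ?_⟩⟩
  · obtain ⟨g, hg⟩ := (isSyzygyClosed_gorenstein hC).toDsg_map_surjective hC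
      X.as.property Y.as.obj f
    exact ⟨(toStable C).map ((gorenstein C).homMk g), hg⟩
  · obtain ⟨f, rfl⟩ := (toStable C).map_surjective (X := X.as) (Y := Y.as) f
    obtain ⟨g, rfl⟩ := (toStable C).map_surjective (X := X.as) (Y := Y.as) g
    exact CategoryTheory.Quotient.sound _ ((stableRel_iff hC f g).2 h)

end Gorenstein

end RelSing

end

theorem proposition4p9 (k : Type w) [Field k] (A : Type u) [Ring A] [Algebra k A]
    [Module.Finite k A] :
    haveI : IsNoetherianRing A := IsNoetherianRing.of_finite k A
    ∀ (C : ObjectProperty (FGModuleCat.{u} A)) [C.IsClosedUnderFiniteProducts]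
      [C.IsStableUnderRetracts], RelSing.IsAdmissible C →
      (∀ M N : FGModuleCat.{u} A, RelSing.leftPerp C M →
        ∃ e : (M ⟶ N) ⧸ RelSing.factoring C M N ≃+
            ((RelSing.toDsg C).obj M ⟶ (RelSing.toDsg C).obj N),
          ∀ f : M ⟶ N, e (QuotientAddGroup.mk f) = (RelSing.toDsg C).map f) ∧
      ∃ θ' : RelSing.StableGorenstein C ⥤ RelSing.Dsg C,
        RelSing.toStable C ⋙ θ' = RelSing.theta C ∧ θ'.Full ∧ θ'.Faithful := by
  intro C _ _ hC
  have : IsNoetherianRing A := IsNoetherianRing.of_finite k A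
  refine ⟨fun M N hM ↦ ?_, RelSing.exists_stable_functor hC⟩
  obtain ⟨Q, hQ, hQM⟩ := RelSing.leftPerp.exists_isSyzygyClosed hC hM
  exact hQ.exists_addEquiv hC hQM N
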